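/- Let $\Gamma$ be a countable discrete group with a sofic approximation $\Sigma=(\sigma_i\colon\Gamma\to S_{d_i})_{i\ge 1}$; that is, the $\sigma_i$ are maps (not necessarily homomorphisms) such that, with $u_d$ the uniform probability measure on $\{1,\dots,d\}$, $u_{d_i}(\{k:\sigma_i(g)\sigma_i(h)(k)=\sigma_i(gh)(k)\})\to 1$ for all $g,h\in\Gamma$ and $u_{d_i}(\{k:\sigma_i(g)(k)\neq\sigma_i(h)(k)\})\to 1$ for all $g\neq h$ in $\Gamma$. Let $\Gamma$ act by measure-preserving transformations on a standard probability space $(X,\mathcal M,\mu)$, let $\rho$ be the unitary representation $(\rho(g)\xi)(x)=\xi(g^{-1}x)$ of $\Gamma$ on $L^2(X,\mu)$, let $\rho^0$ be its restriction to $L^2(X,\mu)\ominus\mathbb C1$, and let $\lambda_\Gamma$ be the left regular representation on $\ell^2(\Gamma)$, $(\lambda_\Gamma(g)f)(x)=f(g^{-1}x)$. Unitary representations $\rho_1,\rho_2$ are called singular, $\rho_1\perp\rho_2$, if no nonzero subrepresentation of $\rho_1$ (restriction to a closed invariant linear subspace) embeds isometrically and equivariantly into $\rho_2$. The sofic entropy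 $h_{\Sigma,\mu}(X,\Gamma)\in[-\infty,\infty]$ is defined as follows. A finite observable is a measurable map from $X$ to a finite set. For a finite observable $\beta\colon X\to B$, a finite $F\subseteq\Gamma$ with $e\in F$, $\delta>0$ and $\sigma\colon\Gamma\to S_d$, let $\mathrm{AP}(\beta,F,\delta,\sigma)$ be the set of all $\phi\colon\{1,\dots,d\}\to B^F$ with $\sum_{a\in B^F}\left|u_d(\phi^{-1}(\{a\}))-\mu(\{x:\beta(g^{-1}x)=a(g)\ \forall g\in F\})\right|<\delta$ and $u_d(\{j:\phi(j)(g)\neq\phi(\sigma(g)^{-1}(j))(e)\})<\delta$ for all $g\in F$. Then \[h_{\Sigma,\mu}(X,\Gamma)=\sup_{\alpha}\ \inf_{\beta,\pi}\ \inf_{F,\delta}\ \limsup_{i\to\infty}\frac1{d_i}\log\left|\left\{j\mapsto\pi(\phi(j)(e))\,:\,\phi\in \mathrm{AP}(\beta,F,\delta,\sigma_i)\right\}\right|,\] where $\log 0=-\infty$, $\alpha\colon X\to A$ and $\beta\colon X\to B$ run over the finite observables, and $\pi\colon B\to A$ over the maps with $\pi\circ\beta=\alpha$ almost everywhere. Let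 $\mathcal H\subseteq L^2(X,\mu)$ be a closed $\Gamma$-invariant linear subspace such that $\mathcal M$ is generated, up to sets of measure zero, by $\{g f^{-1}(A): g\in\Gamma,\ f\in\mathcal H,\ A\subseteq\mathbb C\text{ Borel}\}$. (1) If $\rho|_{\mathcal H}\perp\lambda_\Gamma$, then $h_{\Sigma,\mu}(X,\Gamma)\le 0$. (2) If $\Gamma$ is infinite and the restriction of $\rho^0$ to $\mathcal H\cap(L^2(X,\mu)\ominus\mathbb C1)$ is singular with respect to $\lambda_\Gamma$, then $h_{\Sigma,\mu}(X,\Gamma)\le 0$. -/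

import Mathlib

open MeasureTheory Filter Topology
open scoped ENNReal

/-! ### Sofic approximations -/

/-- The uniform probability `u_d` of the set of points of `{1,…,d}` satisfying `P`. -/
noncomputable def unifProb (d : ℕ) (P : Fin d → Prop) : ℝ :=
  (Set.ncard {k | P k} : ℝ) / d

/-- A sofic approximation of `Γ`: a sequence of maps `σ i : Γ → Sym(d i)` that are asymptotically
multiplicative and asymptotically free. -/
structure SoficApproximation (Γ : Type*) [Group Γ] where
  d : ℕ → ℕ
  d_pos : ∀ i, 0 < d i
  σ : ∀ i, Γ → Equiv.Perm (Fin (d i))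
  tendsto_mul : ∀ g h : Γ,
    Tendsto (fun i => unifProb (d i) fun k => σ i g (σ i h k) = σ i (g * h) k) atTop (𝓝 1)
  tendsto_ne : ∀ g h : Γ, g ≠ h →
    Tendsto (fun i => unifProb (d i) fun k => σ i g k ≠ σ i h k) atTop (𝓝 1)

/-! ### Sofic measure entropy through finite observables -/

section Entropy

variable {Γ : Type*} [Group Γ] {X : Type*} [MeasurableSpace X] [MulAction Γ X]

open scoped Classical in
/-- The approximate microstates `AP(β, F, δ, σ)` of a finite observable `β : X → B`, where `F` is a
finite subset of `Γ` containing the identity: the maps `φ : {1,…,d} → B^F` whose distribution is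
`δ`-close to that of `x ↦ (β (g⁻¹ x))_{g ∈ F}` and which satisfy
`φ(j)(g) = φ(σ(g)⁻¹ j)(e)` for all `j` outside a set of uniform probability less than `δ`. -/
noncomputable def AP (μ : Measure X) {B : Type*} [Fintype B] (β : X → B) (F : Finset Γ) (hF : 1 ∈ F) (δ : ℝ)
    {d : ℕ} (σ : Γ → Equiv.Perm (Fin d)) : Set (Fin d → (F → B)) :=
  {φ | (∑ a : F → B,
          |unifProb d (fun j => φ j = a) - μ.real {x | ∀ g : F, β ((g : Γ)⁻¹ • x) = a g}|) < δ ∧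
        ∀ g : F, unifProb d (fun j => φ j g ≠ φ ((σ g)⁻¹ j) ⟨1, hF⟩) < δ}

/-- `h(α; β, F, δ) = limsup (1 / d_i) log |π*(AP(β, F, δ, σ_i))|`, where `π : B → A` satisfies
`π ∘ β = α` almost everywhere. Here `log 0 = -∞`. -/
noncomputable def obsEntropyAux (Sg : SoficApproximation Γ) (μ : Measure X)
    {A B : Type*} [Fintype B] (β : X → B) (π : B → A) (F : Finset Γ) (hF : 1 ∈ F) (δ : ℝ) : EReal :=
  limsup (fun i =>
    ENNReal.log (((fun φ : Fin (Sg.d i) → (F → B) => fun j => π (φ j ⟨1, hF⟩)) ''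
      AP μ β F hF δ (Sg.σ i)).ncard : ℝ≥0∞) / ((Sg.d i : ℝ) : EReal)) atTop

/-- `h(α; β)`: the infimum of `h(α; β, F, δ)` over finite `F ∋ 1` and `δ > 0`. -/
noncomputable def obsEntropyRel (Sg : SoficApproximation Γ) (μ : Measure X)
    {A B : Type*} [Fintype B] (β : X → B) (π : B → A) : EReal :=
  ⨅ (F : Finset Γ) (hF : 1 ∈ F) (δ : ℝ) (_ : 0 < δ), obsEntropyAux Sg μ β π F hF δ

/-- `h(α)`: the infimum of `h(α; β)` over all finite observables `β` refining `α`. -/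
noncomputable def obsEntropy (Sg : SoficApproximation Γ) (μ : Measure X)
    {A : Type*} (α : X → A) : EReal :=
  ⨅ (m : ℕ) (β : X → Fin m) (_ : Measurable β) (π : Fin m → A) (_ : ∀ᵐ x ∂μ, π (β x) = α x),
    obsEntropyRel Sg μ β π

/-- The sofic measure entropy `h_{Σ,μ}(X, Γ)`, an element of `[-∞, ∞]`: the supremum of `h(α)` over
all finite observables `α`. -/
noncomputable def soficEntropy (Sg : SoficApproximation Γ) (μ : Measure X) : EReal :=
  ⨆ (n : ℕ) (α : X → Fin n) (_ : Measurable α), obsEntropy Sg μ α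

end Entropy

/-! ### Unitary representations -/

/-- A unitary representation of the discrete group `Γ` on `E`. -/
abbrev UnitaryRep (Γ : Type*) [Group Γ] (E : Type*) [NormedAddCommGroup E]
    [InnerProductSpace ℂ E] := Γ →* (E ≃ₗᵢ[ℂ] E)

namespace UnitaryRep

variable {Γ : Type*} [Group Γ]
  {E : Type*} [NormedAddCommGroup E] [InnerProductSpace ℂ E]
  {E' : Type*} [NormedAddCommGroup E'] [InnerProductSpace ℂ E']

/-- The unitary representation given by a multiplicative family of linear isometries. -/
noncomputable def ofIsometries (T : Γ → E →ₗᵢ[ℂ] E) (h1 : ∀ v, T 1 v = v)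
    (hmul : ∀ g h v, T (g * h) v = T g (T h v)) : UnitaryRep Γ E where
  toFun g :=
    { toLinearEquiv := LinearEquiv.ofLinearMap (T g).toLinearMap (T g⁻¹).toLinearMap
        (by ext v; simp [← hmul, h1]) (by ext v; simp [← hmul, h1])
      norm_map' := fun v => (T g).norm_map v }
  map_one' := by ext v; exact h1 v
  map_mul' g h := by ext v; exact hmul g h v

/-- A subrepresentation: a closed invariant linear subspace. -/
def IsSubrep (ρ : UnitaryRep Γ E) (K : Submodule ℂ E) : Prop :=
  IsClosed (K : Set E) ∧ ∀ g : Γ, ∀ v ∈ K, ρ g v ∈ K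

theorem IsSubrep.inf {ρ : UnitaryRep Γ E} {K L : Submodule ℂ E} (hK : ρ.IsSubrep K)
    (hL : ρ.IsSubrep L) : ρ.IsSubrep (K ⊓ L) :=
  ⟨hK.1.inter hL.1, fun g v hv => ⟨hK.2 g v hv.1, hL.2 g v hv.2⟩⟩

/-- The restriction of `ρ` to a subrepresentation `K`. -/
noncomputable def restrict (ρ : UnitaryRep Γ E) (K : Submodule ℂ E) (hK : ρ.IsSubrep K) :
    UnitaryRep Γ K :=
  ofIsometries
    (fun g =>
      { toLinearMap := (ρ g).toLinearEquiv.toLinearMap.restrict (hK.2 g)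
        norm_map' := fun v => (ρ g).norm_map v })
    (fun v => by ext; change ρ 1 (v : E) = v; simp)
    (fun g h v => by ext; change ρ (g * h) (v : E) = ρ g (ρ h v); simp)

/-- `ρ` is singular with respect to `ρ'`: no nonzero subrepresentation of `ρ` embeds
(isometrically and equivariantly) into `ρ'`. -/
def Singular (ρ : UnitaryRep Γ E) (ρ' : UnitaryRep Γ E') : Prop :=
  ∀ (K : Submodule ℂ E) (hK : ρ.IsSubrep K) (T : K →ₗᵢ[ℂ] E'),
    (∀ (g : Γ) (v : K), T (ρ.restrict K hK g v) = ρ' g (T v)) → K = ⊥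

end UnitaryRep

/-- Left translation `(λ(g) f)(x) = f(g⁻¹ x)` on `ℓ²(Γ)`. -/
noncomputable def leftTranslate {Γ : Type*} [Group Γ] (g : Γ) :
    lp (fun _ : Γ => ℂ) 2 →ₗᵢ[ℂ] lp (fun _ : Γ => ℂ) 2 where
  toFun f := ⟨fun x => f (g⁻¹ * x), by
    have h := lp.memℓp f
    rw [memℓp_gen_iff (by norm_num)] at h
    exact (memℓp_gen_iff (by norm_num)).mpr ((Equiv.mulLeft g⁻¹).summable_iff.mpr h)⟩
  map_add' _ _ := rfl
  map_smul' _ _ := rfl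
  norm_map' f := by
    rw [lp.norm_eq_tsum_rpow (by norm_num), lp.norm_eq_tsum_rpow (by norm_num)]
    congr 1
    exact (Equiv.mulLeft g⁻¹).tsum_eq (fun x => ‖f x‖ ^ (2 : ℝ≥0∞).toReal)

/-- The left regular representation of `Γ` on `ℓ²(Γ)`. -/
noncomputable def leftRegular (Γ : Type*) [Group Γ] : UnitaryRep Γ (lp (fun _ : Γ => ℂ) 2) :=
  UnitaryRep.ofIsometries leftTranslate
    (fun f => by ext x; change f (1⁻¹ * x) = f x; simp)
    (fun g h f => by
      ext x; change f ((g * h)⁻¹ * x) = f (h⁻¹ * (g⁻¹ * x)); simp [mul_assoc])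

section Koopman

variable (Γ : Type*) [Group Γ] {X : Type*} [MeasurableSpace X] [MulAction Γ X]
  [MeasurableConstSMul Γ X] (μ : Measure X) [SMulInvariantMeasure Γ X μ]

/-- The representation `(ρ(g) ξ)(x) = ξ(g⁻¹ x)` of `Γ` on `L²(X, μ)`. -/
noncomputable def koopman : UnitaryRep Γ (Lp ℂ 2 μ) :=
  UnitaryRep.ofIsometries
    (fun g => Lp.compMeasurePreservingₗᵢ ℂ (fun x => g⁻¹ • x) (measurePreserving_smul g⁻¹ μ))
    (fun f => by
      refine Lp.ext ((Lp.coeFn_compMeasurePreserving f _).trans ?_)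
      exact Eventually.of_forall fun x => by simp)
    (fun g h f => by
      refine Lp.ext ((Lp.coeFn_compMeasurePreserving f _).trans ?_)
      refine EventuallyEq.symm ((Lp.coeFn_compMeasurePreserving _ _).trans ?_)
      refine ((measurePreserving_smul g⁻¹ μ).quasiMeasurePreserving.ae_eq_comp
        (Lp.coeFn_compMeasurePreserving f (measurePreserving_smul h⁻¹ μ))).trans ?_
      exact Eventually.of_forall fun x => by simp [mul_smul])

/-- `L²(X, μ) ⊖ ℂ1`. -/
noncomputable def meanZero [IsProbabilityMeasure μ] : Submodule ℂ (Lp ℂ 2 μ) :=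
  (Submodule.span ℂ {Lp.const 2 μ (1 : ℂ)})ᗮ

theorem isSubrep_meanZero [IsProbabilityMeasure μ] : (koopman Γ μ).IsSubrep (meanZero μ) := by
  refine ⟨Submodule.isClosed_orthogonal _, fun g v hv => ?_⟩
  have h1 : koopman Γ μ g (Lp.const 2 μ (1 : ℂ)) = Lp.const 2 μ (1 : ℂ) := by
    refine Lp.ext ((Lp.coeFn_compMeasurePreserving _ (measurePreserving_smul g⁻¹ μ)).trans ?_)
    refine ((measurePreserving_smul g⁻¹ μ).quasiMeasurePreserving.ae_eq_comp
      (Lp.coeFn_const (p := 2) (μ := μ) (1 : ℂ))).trans ?_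
    exact (Lp.coeFn_const (p := 2) (μ := μ) (1 : ℂ)).symm
  rw [meanZero, Submodule.mem_orthogonal_singleton_iff_inner_right] at hv ⊢
  rw [← h1, LinearIsometryEquiv.inner_map_map, hv]

variable {μ} in
/-- The `σ`-algebra of `X` is generated, up to sets of measure zero, by the sets `g f⁻¹(A)` for
`g ∈ Γ`, `f ∈ H` and `A ⊆ ℂ` Borel. -/
def Generates (H : Submodule ℂ (Lp ℂ 2 μ)) : Prop :=
  ∀ E : Set X, MeasurableSet E → ∃ E' : Set X,
    MeasurableSet[MeasurableSpace.generateFrom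
      {S : Set X | ∃ (g : Γ) (f : Lp ℂ 2 μ) (A : Set ℂ), f ∈ H ∧ MeasurableSet A ∧
        S = (fun x => g • x) '' ((f : X → ℂ) ⁻¹' A)}] E' ∧ E =ᵐ[μ] E'

end Koopman

/-!
If `ρ` is singular with respect to the regular representation, then finitely many vectors of `ρ` are
almost fixed by an element `c` of the group ring `ℂΓ` that is small in `ℓ²(Γ)`: replacing `ρ` by a
multiple, it is enough to treat one vector `ξ`. The orthogonal projection of `λ_Γ ⊕ ρ` onto the
closed span of the orbit of `(δ₁, ξ)` commutes with the action, so singularity makes its component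
`ρ → λ_Γ` vanish, which forces `(0, ξ)` into that span. By asymptotic freeness the operator `σ_i(c)`
on `ℓ²(d_i)` has Hilbert–Schmidt norm at most `‖c‖₂ √d_i + o(√d_i)`, so the vectors of norm
`O(√d_i)` that it almost fixes lie near a subspace of dimension at most a small multiple of `d_i`.
A microstate turns functions in `H` into such vectors. As `H` generates, finitely many of these
vectors determine a coloring of `{1,…,d_i}` up to a small Hamming distance, and packing bounds for
the subspace together with volume bounds for Hamming balls leave at most `exp(ε d_i)` colorings.
-/

/-! ### Singular representations -/

theorem norm_sqrt_adjoint_comp_self_apply {E : Type*} [NormedAddCommGroup E]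
    [InnerProductSpace ℂ E] [CompleteSpace E] {E' : Type*} [NormedAddCommGroup E']
    [InnerProductSpace ℂ E'] [CompleteSpace E'] (T : E →L[ℂ] E') (x : E) :
    ‖CFC.sqrt (T.adjoint ∘L T) x‖ = ‖T x‖ := by
  set P := T.adjoint ∘L T
  have hP : 0 ≤ P :=
    (ContinuousLinearMap.nonneg_iff_isPositive _).2 T.isPositive_adjoint_comp_self
  have hsa : (CFC.sqrt P).adjoint = CFC.sqrt P := (CFC.sqrt_nonneg P).isSelfAdjoint.star_eq
  rw [ContinuousLinearMap.apply_norm_eq_sqrt_inner_adjoint_right,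
    ContinuousLinearMap.apply_norm_eq_sqrt_inner_adjoint_right, hsa,
    ← ContinuousLinearMap.mul_def, CFC.sqrt_mul_sqrt_self P hP]

theorem exists_linearIsometry_of_denseRange {𝕜 : Type*} [NontriviallyNormedField 𝕜]
    {E F G : Type*} [AddCommGroup E] [Module 𝕜 E] [NormedAddCommGroup F] [NormedSpace 𝕜 F]
    [NormedAddCommGroup G] [NormedSpace 𝕜 G] [CompleteSpace G] {e : E →ₗ[𝕜] F}
    (he : DenseRange e) {T : E →ₗ[𝕜] G} (h : ∀ x, ‖T x‖ = ‖e x‖) :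
    ∃ V : F →ₗᵢ[𝕜] G, ∀ x, V (e x) = T x := by
  have hV : ∀ x, T.extendOfNorm e (e x) = T x :=
    LinearMap.extendOfNorm_eq he ⟨1, fun x => (h x).le.trans (one_mul _).ge⟩
  refine ⟨⟨T.extendOfNorm e, fun y => ?_⟩, hV⟩
  refine he.induction_on (p := fun y => ‖T.extendOfNorm e y‖ = ‖y‖) y
    (isClosed_eq (by fun_prop) (by fun_prop)) fun x => ?_
  rw [hV, h]

theorem denseRange_codRestrict_topologicalClosure {𝕜 : Type*} [Semiring 𝕜] {E F : Type*}
    [AddCommMonoid E] [Module 𝕜 E] [AddCommMonoid F] [Module 𝕜 F] [TopologicalSpace F]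
    [ContinuousAdd F] [ContinuousConstSMul 𝕜 F] (S : E →ₗ[𝕜] F) :
    DenseRange (S.codRestrict S.range.topologicalClosure
      fun x => Submodule.le_topologicalClosure _ ⟨x, rfl⟩) :=
  have hincl : DenseRange (Set.inclusion S.range.le_topologicalClosure) :=
    denseRange_inclusion_iff _ |>.2 subset_rfl
  hincl.comp S.surjective_rangeRestrict.denseRange (continuous_inclusion _)

namespace UnitaryRep

section Intertwiners

variable {Γ : Type*} [Group Γ]
  {E : Type*} [NormedAddCommGroup E] [InnerProductSpace ℂ E]
  {E' : Type*} [NormedAddCommGroup E'] [InnerProductSpace ℂ E']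
  {ρ : UnitaryRep Γ E} {ρ' : UnitaryRep Γ E'}

/-- Disjointness of unitary representations: the only bounded operator intertwining `ρ` and `ρ'`
is zero. -/
def IsDisjoint (ρ : UnitaryRep Γ E) (ρ' : UnitaryRep Γ E') : Prop :=
  ∀ T : E →L[ℂ] E', (∀ g v, T (ρ g v) = ρ' g (T v)) → T = 0

theorem apply_apply_inv (ρ : UnitaryRep Γ E) (g : Γ) (v : E) : ρ g (ρ g⁻¹ v) = v := by
  simp

theorem inner_apply_left (ρ : UnitaryRep Γ E) (g : Γ) (v w : E) :
    inner ℂ (ρ g v) w = inner ℂ v (ρ g⁻¹ w) := by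
  rw [← LinearIsometryEquiv.inner_map_map (ρ g) v, apply_apply_inv]

theorem inner_apply_right (ρ : UnitaryRep Γ E) (g : Γ) (v w : E) :
    inner ℂ v (ρ g w) = inner ℂ (ρ g⁻¹ v) w := by
  rw [inner_apply_left, inv_inv]

theorem isSubrep_topologicalClosure {K : Submodule ℂ E} (hK : ∀ g, ∀ v ∈ K, ρ g v ∈ K) :
    ρ.IsSubrep K.topologicalClosure :=
  ⟨K.isClosed_topologicalClosure, fun g _ hv =>
    Set.MapsTo.closure (f := ρ g) (hK g) (ρ g).continuous hv⟩

theorem IsSubrep.starProjection_apply {K : Submodule ℂ E} [K.HasOrthogonalProjection]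
    (hK : ρ.IsSubrep K) (g : Γ) (v : E) :
    K.starProjection (ρ g v) = ρ g (K.starProjection v) := by
  refine Submodule.eq_starProjection_of_mem_of_inner_eq_zero
    (hK.2 g _ (Submodule.starProjection_apply_mem _ _)) fun w hw => ?_
  rw [← map_sub, inner_apply_left]
  exact Submodule.starProjection_inner_eq_zero _ _ (hK.2 g⁻¹ w hw)

end Intertwiners

section PolarDecomposition

variable {Γ : Type*} [Group Γ]
  {E : Type*} [NormedAddCommGroup E] [InnerProductSpace ℂ E] [CompleteSpace E]
  {E' : Type*} [NormedAddCommGroup E'] [InnerProductSpace ℂ E'] [CompleteSpace E']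
  {ρ : UnitaryRep Γ E} {ρ' : UnitaryRep Γ E'}

theorem adjoint_apply_of_intertwines {T : E →L[ℂ] E'} (hT : ∀ g v, T (ρ g v) = ρ' g (T v))
    (g : Γ) (w : E') : T.adjoint (ρ' g w) = ρ g (T.adjoint w) :=
  ext_inner_left ℂ fun v => by
    rw [T.adjoint_inner_right, inner_apply_right, ← hT, ← T.adjoint_inner_right,
      ← inner_apply_right]

theorem sqrt_apply_of_commutes {P : E →L[ℂ] E} (hP : ∀ g v, P (ρ g v) = ρ g (P v))
    (g : Γ) (v : E) : CFC.sqrt P (ρ g v) = ρ g (CFC.sqrt P v) := by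
  have hcomm : Commute P ((ρ g).toContinuousLinearEquiv : E →L[ℂ] E) :=
    ContinuousLinearMap.ext (hP g)
  rw [CFC.sqrt_eq_cfc]
  exact DFunLike.congr_fun (hcomm.cfc_nnreal _).eq v

theorem Singular.isDisjoint (h : ρ.Singular ρ') : ρ.IsDisjoint ρ' := by
  intro T hT
  set S := CFC.sqrt (T.adjoint ∘L T)
  have hS : ∀ g v, S (ρ g v) = ρ g (S v) := sqrt_apply_of_commutes fun g v => by
    simp only [ContinuousLinearMap.comp_apply, hT, adjoint_apply_of_intertwines hT]
  have hnorm : ∀ x, ‖T x‖ = ‖S x‖ := fun x => (norm_sqrt_adjoint_comp_self_apply T x).symm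
  have hK : ρ.IsSubrep S.range.topologicalClosure := isSubrep_topologicalClosure <| by
    rintro g _ ⟨v, rfl⟩
    exact ⟨ρ g v, hS g v⟩
  have hdense := denseRange_codRestrict_topologicalClosure S.toLinearMap
  set e := S.toLinearMap.codRestrict S.range.topologicalClosure _
  obtain ⟨V, hV⟩ := exists_linearIsometry_of_denseRange (T := T.toLinearMap) hdense hnorm
  have hVρ : ∀ g v, V (ρ.restrict _ hK g v) = ρ' g (V v) := fun g v => by
    refine hdense.induction_on (p := fun v => V (ρ.restrict _ hK g v) = ρ' g (V v)) v
      (isClosed_eq (by fun_prop) (by fun_prop)) fun x => ?_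
    have he : ρ.restrict _ hK g (e x) = e (ρ g x) := Subtype.ext (hS g x).symm
    rw [he, hV, hV]
    exact hT g x
  have hbot := h _ hK V hVρ
  ext x
  have hSx : S x ∈ S.range.topologicalClosure := (e x).2
  rw [hbot, Submodule.mem_bot] at hSx
  rw [zero_apply, ← norm_eq_zero, hnorm, hSx, norm_zero]

end PolarDecomposition

section DirectSums

variable {Γ : Type*} [Group Γ]
  {E : Type*} [NormedAddCommGroup E] [InnerProductSpace ℂ E]
  {E' : Type*} [NormedAddCommGroup E'] [InnerProductSpace ℂ E']

/-- The direct sum of two unitary representations, on the Hilbert sum of their spaces. -/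
noncomputable def prod (ρ : UnitaryRep Γ E) (ρ' : UnitaryRep Γ E') :
    UnitaryRep Γ (WithLp 2 (E × E')) where
  toFun g := LinearIsometryEquiv.withLpProdCongr 2 (ρ g) (ρ' g)
  map_one' := by simp only [map_one]; rfl
  map_mul' _ _ := by simp only [map_mul]; rfl

/-- The direct sum of `ι` copies of `ρ`. -/
noncomputable def diagonal (ι : Type*) [Fintype ι] (ρ : UnitaryRep Γ E) :
    UnitaryRep Γ (PiLp 2 fun _ : ι => E) where
  toFun g := LinearIsometryEquiv.piLpCongrRight 2 fun _ => ρ g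
  map_one' := by ext; simp
  map_mul' _ _ := by ext; simp

theorem IsDisjoint.diagonal {ρ : UnitaryRep Γ E} {ρ' : UnitaryRep Γ E'} (h : ρ.IsDisjoint ρ')
    (ι : Type*) [Fintype ι] : (ρ.diagonal ι).IsDisjoint ρ' := by
  classical
  intro T hT
  let incl (k : ι) : E →L[ℂ] PiLp 2 fun _ : ι => E :=
    (PiLp.continuousLinearEquiv 2 ℂ fun _ : ι => E).symm.toContinuousLinearMap ∘L
      ContinuousLinearMap.single ℂ (fun _ : ι => E) k
  have hincl : ∀ k g v, incl k (ρ g v) = ρ.diagonal ι g (incl k v) := fun k g v => by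
    ext l
    exact (Pi.apply_single (fun _ => ρ g) (fun _ => map_zero _) k v l).symm
  have hzero : ∀ k v, T (incl k v) = 0 := fun k v => by
    have hk := h (T ∘L incl k) fun g v => by
      change T (incl k (ρ g v)) = ρ' g (T (incl k v))
      rw [hincl, hT]
    exact DFunLike.congr_fun hk v
  ext x
  have hx : x = ∑ k, incl k (x k) := by
    ext l
    simp [incl, Finset.sum_apply, Pi.single_apply]
  rw [hx, map_sum, Finset.sum_eq_zero fun k _ => hzero k _, zero_apply]

theorem IsDisjoint.inr_mem {ρ : UnitaryRep Γ E} {ρ' : UnitaryRep Γ E'} (h : ρ'.IsDisjoint ρ)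
    {K : Submodule ℂ (WithLp 2 (E × E'))} [K.HasOrthogonalProjection]
    (hK : (ρ.prod ρ').IsSubrep K) {v : E} {v' : E'} (hv : WithLp.toLp 2 (v, v') ∈ K) :
    WithLp.toLp 2 (0, v') ∈ K := by
  let inr : E' →L[ℂ] WithLp 2 (E × E') :=
    (WithLp.prodContinuousLinearEquiv 2 ℂ E E').symm.toContinuousLinearMap ∘L
      ContinuousLinearMap.inr ℂ E E'
  have hfst : (K.starProjection (inr v')).fst = 0 := by
    refine DFunLike.congr_fun (h (WithLp.fstL 2 ℂ E E' ∘L K.starProjection ∘L inr) ?_) v'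
    intro g w
    have hinr : inr (ρ' g w) = ρ.prod ρ' g (inr w) := by
      change WithLp.toLp 2 (0, ρ' g w) = WithLp.toLp 2 (ρ g 0, ρ' g w)
      rw [map_zero]
    rw [ContinuousLinearMap.comp_apply, ContinuousLinearMap.comp_apply, hinr,
      hK.starProjection_apply]
    rfl
  -- `z` is orthogonal to `K` and has first coordinate zero: pairing it with the vector `hv` of `K`
  -- shows that it is orthogonal to `inr v'`, and therefore to itself.
  set z := inr v' - K.starProjection (inr v') with hz
  have hzfst : z.fst = 0 := by
    rw [hz, WithLp.sub_fst, hfst, sub_zero]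
    rfl
  have hzK : ∀ y ∈ K, inner ℂ z y = 0 := K.starProjection_inner_eq_zero (inr v')
  have hzinr : inner ℂ z (inr v') = 0 := by
    have hzv := hzK _ hv
    rw [WithLp.prod_inner_apply] at hzv ⊢
    rw [← hzv, show (WithLp.ofLp z).1 = 0 from hzfst, inner_zero_left, inner_zero_left]
    rfl
  have hzero : inner ℂ z z = 0 := by
    nth_rewrite 2 [hz]
    rw [inner_sub_right, hzinr, hzK _ (K.starProjection_apply_mem _), sub_zero]
  change inr v' ∈ K
  rw [sub_eq_zero.1 (inner_self_eq_zero.1 hzero)]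
  exact K.starProjection_apply_mem _

end DirectSums

section GroupRing

variable {Γ : Type*} {E : Type*} [NormedAddCommGroup E] [InnerProductSpace ℂ E]

/-- The linear extension `c ↦ ∑ g, c g • U g` to the group ring `ℂΓ` of a family of unitaries `U`,
which need not be multiplicative. -/
noncomputable def linearExtension (U : Γ → E ≃ₗᵢ[ℂ] E) : (Γ →₀ ℂ) →ₗ[ℂ] E →L[ℂ] E :=
  Finsupp.linearCombination ℂ fun g => ((U g).toContinuousLinearEquiv : E →L[ℂ] E)

theorem linearExtension_apply (U : Γ → E ≃ₗᵢ[ℂ] E) (c : Γ →₀ ℂ) (v : E) :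
    linearExtension U c v = ∑ g ∈ c.support, c g • U g v := by
  rw [linearExtension, Finsupp.linearCombination_apply, Finsupp.sum, sum_apply]
  rfl

theorem norm_linearExtension_apply_le (U : Γ → E ≃ₗᵢ[ℂ] E) (c : Γ →₀ ℂ) (v : E) :
    ‖linearExtension U c v‖ ≤ (∑ g ∈ c.support, ‖c g‖) * ‖v‖ := by
  rw [linearExtension_apply, Finset.sum_mul]
  refine (norm_sum_le _ _).trans_eq (Finset.sum_congr rfl fun g _ => ?_)
  rw [norm_smul, LinearIsometryEquiv.norm_map]

theorem coe_linearExtension_restrict [Group Γ] {ρ : UnitaryRep Γ E} {K : Submodule ℂ E}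
    (hK : ρ.IsSubrep K) (c : Γ →₀ ℂ) (v : K) :
    (linearExtension (ρ.restrict K hK) c v : E) = linearExtension ρ c v := by
  rw [linearExtension_apply, linearExtension_apply, Submodule.coe_sum]
  rfl

end GroupRing

end UnitaryRep

theorem leftRegular_single {Γ : Type*} [Group Γ] [DecidableEq Γ] (g h : Γ) (c : ℂ) :
    leftRegular Γ g (lp.single 2 h c) = lp.single 2 (g * h) c := by
  ext x
  change (lp.single 2 h c : lp (fun _ : Γ => ℂ) 2) (g⁻¹ * x) = _
  simp only [lp.single_apply, Pi.single_apply, inv_mul_eq_iff_eq_mul]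

namespace UnitaryRep

section AlmostFixed

variable {Γ : Type*} [Group Γ] {E : Type*} [NormedAddCommGroup E] [InnerProductSpace ℂ E]
  [CompleteSpace E] {ρ : UnitaryRep Γ E}

theorem IsDisjoint.inr_mem_closure_cyclic [DecidableEq Γ] (h : ρ.IsDisjoint (leftRegular Γ))
    (ξ : E) :
    WithLp.toLp 2 ((0 : lp (fun _ : Γ => ℂ) 2), ξ) ∈ closure (Submodule.span ℂ
      (Set.range fun g : Γ => WithLp.toLp 2
        ((lp.single 2 g 1 : lp (fun _ : Γ => ℂ) 2), ρ g ξ)) : Set _) := by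
  set w : Γ → WithLp 2 (lp (fun _ : Γ => ℂ) 2 × E) :=
    fun g => WithLp.toLp 2 (lp.single 2 g 1, ρ g ξ)
  have hw : ∀ g k, (leftRegular Γ).prod ρ g (w k) = w (g * k) := fun g k => by
    change WithLp.toLp 2 (leftRegular Γ g (lp.single 2 k 1), ρ g (ρ k ξ)) =
      WithLp.toLp 2 (lp.single 2 (g * k) 1, ρ (g * k) ξ)
    rw [leftRegular_single, map_mul]
    rfl
  have hspan : ∀ g, Submodule.span ℂ (Set.range w) ≤ (Submodule.span ℂ (Set.range w)).comap
      ((leftRegular Γ).prod ρ g).toLinearEquiv.toLinearMap := fun g => by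
    rw [Submodule.span_le]
    rintro _ ⟨k, rfl⟩
    exact Submodule.subset_span ⟨g * k, (hw g k).symm⟩
  have hK : ((leftRegular Γ).prod ρ).IsSubrep
      (Submodule.span ℂ (Set.range w)).topologicalClosure := isSubrep_topologicalClosure hspan
  have : CompleteSpace (Submodule.span ℂ (Set.range w)).topologicalClosure :=
    hK.1.completeSpace_coe
  refine h.inr_mem hK (v := lp.single 2 1 1) (Submodule.le_topologicalClosure _ ?_)
  refine Submodule.subset_span ⟨1, ?_⟩
  change WithLp.toLp 2 (lp.single 2 1 1, ρ 1 ξ) = _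
  rw [map_one]
  rfl

theorem IsDisjoint.exists_linearExtension_near (h : ρ.IsDisjoint (leftRegular Γ)) (ξ : E) {ε : ℝ}
    (hε : 0 < ε) : ∃ c : Γ →₀ ℂ, ∑ g ∈ c.support, ‖c g‖ ^ 2 < ε ^ 2 ∧
      ‖linearExtension ρ c ξ - ξ‖ < ε := by
  classical
  obtain ⟨y, hy, hdist⟩ := Metric.mem_closure_iff.1 (h.inr_mem_closure_cyclic ξ) ε hε
  obtain ⟨c, rfl⟩ := Finsupp.mem_span_range_iff_exists_finsupp.1 hy
  set y := c.sum fun g a =>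
    a • WithLp.toLp 2 ((lp.single 2 g 1 : lp (fun _ : Γ => ℂ) 2), ρ g ξ) with hy'
  have hfst : y.fst = ∑ g ∈ c.support, lp.single 2 g (c g) := by
    change WithLp.fstₗ 2 ℂ _ _ y = _
    rw [hy', Finsupp.sum, map_sum]
    refine Finset.sum_congr rfl fun g _ => ?_
    change c g • (lp.single 2 g (1 : ℂ) : lp (fun _ : Γ => ℂ) 2) = _
    rw [← lp.single_smul, smul_eq_mul, mul_one]
  have hsnd : y.snd = linearExtension ρ c ξ := by
    change WithLp.sndₗ 2 ℂ _ _ y = _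
    rw [hy', Finsupp.sum, map_sum, linearExtension_apply]
    rfl
  have hnorm : ‖y - WithLp.toLp 2 (0, ξ)‖ ^ 2 =
      ∑ g ∈ c.support, ‖c g‖ ^ 2 + ‖linearExtension ρ c ξ - ξ‖ ^ 2 := by
    have hsingle := lp.norm_sum_single (p := 2) (by norm_num) (fun g => c g) c.support
    norm_num at hsingle
    rw [WithLp.prod_norm_sq_eq_of_L2, WithLp.sub_fst, WithLp.sub_snd, hfst, hsnd, ← hsingle]
    congr 3
    exact sub_zero _
  have hlt : ‖y - WithLp.toLp 2 (0, ξ)‖ ^ 2 < ε ^ 2 := by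
    rw [← dist_eq_norm, dist_comm]
    gcongr
  have hc : 0 ≤ ∑ g ∈ c.support, ‖c g‖ ^ 2 := by positivity
  refine ⟨c, ?_, lt_of_pow_lt_pow_left₀ 2 hε.le ?_⟩ <;>
    nlinarith [sq_nonneg ‖linearExtension ρ c ξ - ξ‖]

theorem Singular.exists_linearExtension_near (h : ρ.Singular (leftRegular Γ)) {ι : Type*}
    [Finite ι] (ξ : ι → E) {τ a : ℝ} (hτ : 0 < τ) (ha : 0 < a) :
    ∃ c : Γ →₀ ℂ, ∑ g ∈ c.support, ‖c g‖ ^ 2 < τ ∧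
      ∀ k, ‖linearExtension ρ c (ξ k) - ξ k‖ < a := by
  have := Fintype.ofFinite ι
  obtain ⟨c, hc, hfix⟩ := (h.isDisjoint.diagonal ι).exists_linearExtension_near
    (WithLp.toLp 2 ξ) (ε := min (√τ) a) (by positivity)
  refine ⟨c, hc.trans_le ?_, fun k => ?_⟩
  · calc (min (√τ) a) ^ 2 ≤ √τ ^ 2 := by gcongr; exact min_le_left _ _
      _ = τ := Real.sq_sqrt hτ.le
  · have hk : linearExtension (ρ.diagonal ι) c (WithLp.toLp 2 ξ) k = linearExtension ρ c (ξ k) := by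
      rw [linearExtension_apply, linearExtension_apply, WithLp.ofLp_sum, Finset.sum_apply]
      rfl
    rw [← hk]
    exact ((PiLp.norm_apply_le _ k).trans_lt hfix).trans_le (min_le_right _ _)

end AlmostFixed

end UnitaryRep

/-! ### Low-rank approximation -/

section LowRank

variable {𝕜 : Type*} [RCLike 𝕜] {E : Type*} [NormedAddCommGroup E] [InnerProductSpace 𝕜 E]
  [FiniteDimensional 𝕜 E] {F : Type*} [NormedAddCommGroup F] [InnerProductSpace 𝕜 F]

theorem norm_sum_sq_of_pairwise_inner_eq_zero {ι : Type*} {f : ι → F} {s : Finset ι}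
    (hf : (s : Set ι).Pairwise fun k l => inner 𝕜 (f k) (f l) = 0) :
    ‖∑ l ∈ s, f l‖ ^ 2 = ∑ l ∈ s, ‖f l‖ ^ 2 := by
  have horth : OrthogonalFamily 𝕜 (fun l : s => 𝕜 ∙ f l) fun l => (𝕜 ∙ f l).subtypeₗᵢ :=
    OrthogonalFamily.of_pairwise fun k l hkl => Submodule.isOrtho_span.2 <| by
      simpa using hf k.2 l.2 (Subtype.coe_injective.ne hkl)
  rw [← Finset.sum_coe_sort, ← Finset.sum_coe_sort s fun l => ‖f l‖ ^ 2]
  exact horth.norm_sum (fun l => ⟨f l, Submodule.mem_span_singleton_self _⟩) Finset.univ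

variable [FiniteDimensional 𝕜 F]

theorem ofReal_sum_norm_sq_apply {ι : Type*} [Fintype ι] (A : E →ₗ[𝕜] F)
    (b : OrthonormalBasis ι 𝕜 E) :
    ((∑ l, ‖A (b l)‖ ^ 2 : ℝ) : 𝕜) = LinearMap.trace 𝕜 E (A.adjoint ∘ₗ A) := by
  rw [LinearMap.trace_eq_sum_inner _ b]
  push_cast
  refine Finset.sum_congr rfl fun l _ => ?_
  rw [← inner_self_eq_norm_sq_to_K, ← LinearMap.adjoint_inner_right]
  rfl

theorem sum_norm_sq_apply_eq {ι ι' : Type*} [Fintype ι] [Fintype ι'] (A : E →ₗ[𝕜] F)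
    (b : OrthonormalBasis ι 𝕜 E) (b' : OrthonormalBasis ι' 𝕜 E) :
    ∑ l, ‖A (b l)‖ ^ 2 = ∑ l, ‖A (b' l)‖ ^ 2 :=
  RCLike.ofReal_injective
    ((ofReal_sum_norm_sq_apply A b).trans (ofReal_sum_norm_sq_apply A b').symm)

theorem exists_orthonormalBasis_pairwise_inner_apply_eq_zero (A : E →ₗ[𝕜] F) :
    ∃ u : OrthonormalBasis (Fin (Module.finrank 𝕜 E)) 𝕜 E,
      Pairwise fun k l => inner 𝕜 (A (u k)) (A (u l)) = 0 := by
  have hsymm := A.isPositive_adjoint_comp_self.isSymmetric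
  refine ⟨hsymm.eigenvectorBasis rfl, fun k l hkl => ?_⟩
  beta_reduce
  rw [← LinearMap.adjoint_inner_right, ← LinearMap.comp_apply, hsymm.apply_eigenvectorBasis,
    inner_smul_right, (hsymm.eigenvectorBasis rfl).orthonormal.2 hkl, mul_zero]

theorem exists_submodule_finrank_mul_sq_le {ι : Type*} [Fintype ι] (e : OrthonormalBasis ι 𝕜 E)
    (A : E →ₗ[𝕜] F) {t : ℝ} (ht : 0 ≤ t) :
    ∃ W : Submodule 𝕜 F, (Module.finrank 𝕜 W : ℝ) * t ^ 2 ≤ ∑ l, ‖A (e l)‖ ^ 2 ∧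
      ∀ v, ∃ w ∈ W, ‖A v - w‖ ≤ t * ‖v‖ := by
  classical
  obtain ⟨u, hu⟩ := exists_orthonormalBasis_pairwise_inner_apply_eq_zero A
  let S := Finset.univ.filter fun l => t < ‖A (u l)‖
  refine ⟨Submodule.span 𝕜 (S.image (A ∘ u) : Finset F), ?_, fun v =>
    ⟨∑ l ∈ S, inner 𝕜 (u l) v • A (u l), ?_, ?_⟩⟩
  · calc (Module.finrank 𝕜 (Submodule.span 𝕜 (S.image (A ∘ u) : Set F)) : ℝ) * t ^ 2
      _ ≤ S.card * t ^ 2 := by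
        gcongr
        exact (finrank_span_finset_le_card _).trans Finset.card_image_le
      _ = ∑ _l ∈ S, t ^ 2 := by rw [Finset.sum_const, nsmul_eq_mul]
      _ ≤ ∑ l ∈ S, ‖A (u l)‖ ^ 2 := Finset.sum_le_sum fun l hl => by
        gcongr
        exact (Finset.mem_filter.1 hl).2.le
      _ ≤ ∑ l, ‖A (u l)‖ ^ 2 := Finset.sum_le_univ_sum_of_nonneg fun _ => by positivity
      _ = ∑ l, ‖A (e l)‖ ^ 2 := sum_norm_sq_apply_eq A u e
  · refine Submodule.sum_mem _ fun l hl => Submodule.smul_mem _ _ (Submodule.subset_span ?_)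
    exact Finset.mem_coe.2 (Finset.mem_image_of_mem (A ∘ u) hl)
  · have hAv : A v - ∑ l ∈ S, inner 𝕜 (u l) v • A (u l) = ∑ l ∈ Sᶜ, inner 𝕜 (u l) v • A (u l) := by
      rw [sub_eq_iff_eq_add', Finset.sum_add_sum_compl]
      conv_lhs => rw [← u.sum_repr' v]
      simp only [map_sum, map_smul]
    have horth : Pairwise fun k l =>
        inner 𝕜 (inner 𝕜 (u k) v • A (u k)) (inner 𝕜 (u l) v • A (u l)) = 0 := fun k l hkl => by
      beta_reduce
      rw [inner_smul_left, inner_smul_right, hu hkl, mul_zero, mul_zero]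
    refine (sq_le_sq₀ (norm_nonneg _) (by positivity)).1 ?_
    rw [hAv, norm_sum_sq_of_pairwise_inner_eq_zero (horth.set_pairwise _), mul_pow,
      ← u.sum_sq_norm_inner_right v, Finset.mul_sum]
    calc ∑ l ∈ Sᶜ, ‖inner 𝕜 (u l) v • A (u l)‖ ^ 2
      _ ≤ ∑ l ∈ Sᶜ, t ^ 2 * ‖inner 𝕜 (u l) v‖ ^ 2 := Finset.sum_le_sum fun l hl => by
        have hl : ‖A (u l)‖ ≤ t := by simpa [S] using hl
        rw [norm_smul, mul_pow, mul_comm]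
        gcongr
      _ ≤ ∑ l, t ^ 2 * ‖inner 𝕜 (u l) v‖ ^ 2 :=
        Finset.sum_le_univ_sum_of_nonneg fun _ => by positivity

end LowRank

/-! ### Counting -/

theorem sum_pow_hammingDist {ι α R : Type*} [Fintype ι] [DecidableEq ι] [Fintype α] [DecidableEq α]
    [CommRing R] (y : ι → α) (x : R) :
    ∑ z : ι → α, x ^ hammingDist y z = (1 + (Fintype.card α - 1) * x) ^ Fintype.card ι := by
  have hprod : ∀ z : ι → α, x ^ hammingDist y z = ∏ j, if y j = z j then 1 else x := fun z => by
    rw [Finset.prod_ite, Finset.prod_const_one, one_mul, Finset.prod_const]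
    rfl
  have hsum : ∀ j, ∑ a, (if y j = a then 1 else x) = 1 + (Fintype.card α - 1) * x := fun j => by
    have hite : ∀ a, (if y j = a then 1 else x) = (if y j = a then 1 - x else 0) + x := fun a => by
      split_ifs <;> ring
    simp only [hite, Finset.sum_add_distrib, Finset.sum_ite_eq, Finset.mem_univ, if_true,
      Finset.sum_const, Finset.card_univ, nsmul_eq_mul]
    ring
  simp_rw [hprod]
  rw [← Fintype.prod_sum (fun j a => if y j = a then 1 else x)]
  simp only [hsum, Finset.prod_const, Finset.card_univ]

theorem ncard_hammingBall_le_exp {ι α : Type*} [Fintype ι] [Fintype α] [DecidableEq α]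
    (y : ι → α) {x : ℝ} (hx : 0 < x) (hx1 : x ≤ 1) (r : ℝ) :
    ({z | (hammingDist y z : ℝ) ≤ r}.ncard : ℝ) ≤
      Real.exp (Fintype.card α * x * Fintype.card ι - r * Real.log x) := by
  classical
  have hmarkov : ({z | (hammingDist y z : ℝ) ≤ r}.ncard : ℝ) * Real.exp (r * Real.log x) ≤
      ∑ z : ι → α, x ^ hammingDist y z := by
    rw [Set.ncard_eq_toFinset_card', ← nsmul_eq_mul]
    refine (Finset.card_nsmul_le_sum _ _ _ fun z hz => ?_).trans
      (Finset.sum_le_univ_sum_of_nonneg fun _ => by positivity)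
    have hz : (hammingDist y z : ℝ) ≤ r := by simpa using hz
    rw [← Real.rpow_natCast, Real.rpow_def_of_pos hx, mul_comm]
    exact Real.exp_le_exp.2 (mul_le_mul_of_nonpos_left hz (Real.log_nonpos hx.le hx1))
  have hgrowth : ∑ z : ι → α, x ^ hammingDist y z ≤
      Real.exp (Fintype.card α * x * Fintype.card ι) := by
    rw [sum_pow_hammingDist, mul_comm _ (Fintype.card ι : ℝ), Real.exp_nat_mul]
    have hexp := Real.add_one_le_exp (Fintype.card α * x)
    have hcard : 0 ≤ Fintype.card α * x := by positivity
    exact pow_le_pow_left₀ (by linarith) (by linarith) _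
  rw [Real.exp_sub, le_div_iff₀ (Real.exp_pos _)]
  exact hmarkov.trans hgrowth

theorem exists_ncard_hammingBall_le_exp (α : Type*) [Finite α] [DecidableEq α] {ε : ℝ}
    (hε : 0 < ε) : ∃ γ : ℝ, 0 < γ ∧ ∀ {ι : Type*} [Fintype ι] (y : ι → α),
      ({z | (hammingDist y z : ℝ) ≤ γ * Fintype.card ι}.ncard : ℝ) ≤
        Real.exp (ε * Fintype.card ι) := by
  have := Fintype.ofFinite α
  obtain ⟨x, hx, hxε⟩ := exists_pos_mul_lt (half_pos hε) (Fintype.card α)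
  obtain ⟨γ, hγ, hγε⟩ := exists_pos_mul_lt (half_pos hε) (-Real.log (min x 1))
  refine ⟨γ, hγ, fun {ι} _ y =>
    (ncard_hammingBall_le_exp y (lt_min hx one_pos) (min_le_right x 1) _).trans
      (Real.exp_le_exp.2 ?_)⟩
  have hcard : (Fintype.card α : ℝ) * min x 1 ≤ ε / 2 :=
    (mul_le_mul_of_nonneg_left (min_le_left x 1) (Nat.cast_nonneg _)).trans hxε.le
  calc Fintype.card α * min x 1 * Fintype.card ι - γ * Fintype.card ι * Real.log (min x 1)
    _ = (Fintype.card α * min x 1 + -Real.log (min x 1) * γ) * Fintype.card ι := by ring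
    _ ≤ ε * Fintype.card ι := by gcongr; linarith

section Packing

variable {V : Type*} [NormedAddCommGroup V] [NormedSpace ℝ V] [FiniteDimensional ℝ V]

theorem card_le_pow_finrank_of_separated (C : Finset V) {R r : ℝ} (hR : 0 ≤ R) (hr : 0 < r)
    (hC : ∀ c ∈ C, ‖c‖ ≤ R) (hsep : (C : Set V).Pairwise fun c d => r ≤ dist c d) :
    (C.card : ℝ) ≤ (1 + 2 * R / r) ^ Module.finrank ℝ V := by
  borelize V
  let μ : Measure V := Measure.addHaar
  have hball {s : ℝ} (hs : 0 < s) (c : V) :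
      μ.real (Metric.ball c s) = s ^ Module.finrank ℝ V * μ.real (Metric.ball 0 1) := by
    rw [measureReal_def, μ.addHaar_ball_of_pos _ hs, ENNReal.toReal_mul,
      ENNReal.toReal_ofReal (by positivity), measureReal_def]
  have hdisj : (C : Set V).Pairwise (Function.onFun Disjoint fun c => Metric.ball c (r / 2)) :=
    fun c hc d hd hcd => Metric.ball_disjoint_ball (by rw [add_halves]; exact hsep hc hd hcd)
  have hsub : ⋃ c ∈ C, Metric.ball c (r / 2) ⊆ Metric.ball (0 : V) (R + r / 2) :=
    Set.iUnion₂_subset fun c hc => Metric.ball_subset_ball' <| by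
      rw [dist_zero_right, add_comm]
      gcongr
      exact hC c hc
  have hvol : C.card * ((r / 2) ^ Module.finrank ℝ V * μ.real (Metric.ball 0 1)) ≤
      (R + r / 2) ^ Module.finrank ℝ V * μ.real (Metric.ball 0 1) :=
    calc C.card * ((r / 2) ^ Module.finrank ℝ V * μ.real (Metric.ball 0 1))
      _ = ∑ c ∈ C, μ.real (Metric.ball c (r / 2)) := by
        simp only [hball (half_pos hr), Finset.sum_const, nsmul_eq_mul]
      _ = μ.real (⋃ c ∈ C, Metric.ball c (r / 2)) :=
        (measureReal_biUnion_finset hdisj fun _ _ => measurableSet_ball).symm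
      _ ≤ μ.real (Metric.ball 0 (R + r / 2)) := measureReal_mono hsub measure_ball_lt_top.ne
      _ = _ := hball (by positivity) 0
  have hpos : 0 < μ.real (Metric.ball (0 : V) 1) :=
    ENNReal.toReal_pos (Metric.measure_ball_pos μ _ one_pos).ne' measure_ball_lt_top.ne
  rw [← mul_assoc, mul_le_mul_iff_left₀ hpos, ← le_div_iff₀ (by positivity), ← div_pow] at hvol
  have hratio : (R + r / 2) / (r / 2) = 1 + 2 * R / r := by
    field_simp
    ring
  rwa [hratio] at hvol

theorem exists_finset_isCover_card_le {K : Set V} {R r : ℝ} (hR : 0 ≤ R) (hr : 0 < r)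
    (hK : ∀ v ∈ K, ‖v‖ ≤ R) : ∃ C : Finset V, (C : Set V) ⊆ K ∧ (∀ v ∈ K, ∃ c ∈ C, ‖v - c‖ ≤ r) ∧
      (C.card : ℝ) ≤ (1 + 2 * R / r) ^ Module.finrank ℝ V := by
  have hcard (C : Finset V) (hCK : (C : Set V) ⊆ K)
      (hC : Metric.IsSeparated (ENNReal.ofReal r) (C : Set V)) :
      (C.card : ℝ) ≤ (1 + 2 * R / r) ^ Module.finrank ℝ V :=
    card_le_pow_finrank_of_separated C hR hr (fun c hc => hK c (hCK hc)) fun c hc d hd hcd =>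
      (ENNReal.ofReal_le_iff_le_toReal (edist_ne_top c d)).1 (hC hc hd hcd).le |>.trans_eq
        (dist_edist c d).symm
  have hpack : Metric.packingNumber r.toNNReal K ≤ ⌊(1 + 2 * R / r) ^ Module.finrank ℝ V⌋₊ := by
    refine iSup_le fun C => iSup₂_le fun hCK hC => le_of_not_gt fun hlt => ?_
    obtain ⟨D, hDC, hD⟩ := Set.exists_subset_encard_eq (Order.add_one_le_of_lt hlt)
    lift D to Finset V using Set.finite_of_encard_le_coe hD.le
    rw [Set.encard_coe_eq_coe_finsetCard] at hD
    have hDcard := Nat.le_floor (hcard D (hDC.trans hCK) (hC.subset hDC))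
    norm_cast at hD
    omega
  have htop := ne_top_of_le_ne_top (ENat.natCast_ne_top _) hpack
  have hcover := Metric.isCover_maximalSeparatedSet htop
  have hfin : (Metric.maximalSeparatedSet r.toNNReal K).Finite :=
    Set.encard_ne_top_iff.1 (Metric.encard_maximalSeparatedSet htop ▸ htop)
  refine ⟨hfin.toFinset, ?_, fun v hv => ?_, hcard _ ?_ ?_⟩
  · simpa using Metric.maximalSeparatedSet_subset
  · obtain ⟨c, hc, hvc⟩ := hcover hv
    refine ⟨c, by simpa using hc, ?_⟩
    rw [← dist_eq_norm]
    exact (edist_le_ofReal hr.le).1 hvc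
  · simpa using Metric.maximalSeparatedSet_subset
  · rw [hfin.coe_toFinset]
    exact Metric.isSeparated_maximalSeparatedSet

theorem ncard_image_le_pow_finrank_mul {Φ Y : Type*} [Finite Y] (P : Set Φ) (p : Φ → Y)
    (w : Φ → V) (B : Y → Set Y) {R r N : ℝ} (hR : 0 ≤ R) (hr : 0 < r) (hN₀ : 0 ≤ N)
    (hw : ∀ φ ∈ P, ‖w φ‖ ≤ R) (hB : ∀ φ ∈ P, ∀ ψ ∈ P, ‖w φ - w ψ‖ ≤ r → p φ ∈ B (p ψ))
    (hN : ∀ y, ((B y).ncard : ℝ) ≤ N) :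
    ((p '' P).ncard : ℝ) ≤ (1 + 2 * R / r) ^ Module.finrank ℝ V * N := by
  obtain ⟨C, hCP, hcover, hcard⟩ := exists_finset_isCover_card_le (K := w '' P) hR hr
    (Set.forall_mem_image.2 hw)
  choose f hfP hfw using hCP
  have hsub : p '' P ⊆ ⋃ c : C, B (p (f c.2)) := by
    rintro _ ⟨φ, hφ, rfl⟩
    obtain ⟨c, hc, hφc⟩ := hcover (w φ) ⟨φ, hφ, rfl⟩
    refine Set.mem_iUnion.2 ⟨⟨c, hc⟩, hB φ hφ _ (hfP hc) ?_⟩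
    rwa [hfw]
  calc ((p '' P).ncard : ℝ)
    _ ≤ ∑ c : C, ((B (p (f c.2))).ncard : ℝ) := by
      exact_mod_cast (Set.ncard_le_ncard hsub).trans (Set.ncard_iUnion_le_of_fintype _)
    _ ≤ C.card * N := by
      simpa using Finset.sum_le_card_nsmul Finset.univ _ N fun (c : C) _ => hN (p (f c.2))
    _ ≤ (1 + 2 * R / r) ^ Module.finrank ℝ V * N := by
      gcongr

end Packing

section AlmostFixed

variable {ι E : Type*} [Fintype ι] [NormedAddCommGroup E] [InnerProductSpace ℂ E]
  [FiniteDimensional ℂ E] (e : OrthonormalBasis ι ℂ E) (A : E →ₗ[ℂ] E)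

theorem exists_submodule_near_of_norm_apply_sub_le {R a : ℝ} (hR : 0 < R) (ha : 0 < a) :
    ∃ W : Submodule ℂ E, Module.finrank ℂ W ≤ (R / a) ^ 2 * ∑ l, ‖A (e l)‖ ^ 2 ∧
      ∀ v, ‖v‖ ≤ R → ‖A v - v‖ ≤ a → ∃ w : W, ‖(w : E) - v‖ ≤ 2 * a := by
  obtain ⟨W, hWrank, hW⟩ := exists_submodule_finrank_mul_sq_le e A (t := a / R) (by positivity)
  refine ⟨W, ?_, fun v hv hAv => ?_⟩
  · calc (Module.finrank ℂ W : ℝ)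
      _ = (R / a) ^ 2 * (Module.finrank ℂ W * (a / R) ^ 2) := by field_simp
      _ ≤ (R / a) ^ 2 * ∑ l, ‖A (e l)‖ ^ 2 := by gcongr
  · obtain ⟨w, hwW, hw⟩ := hW v
    refine ⟨⟨w, hwW⟩, ?_⟩
    calc ‖w - v‖
      _ ≤ ‖w - A v‖ + ‖A v - v‖ := norm_sub_le_norm_sub_add_norm_sub _ _ _
      _ ≤ a / R * R + a := by
        rw [norm_sub_rev]
        gcongr
        exact hw.trans (by gcongr)
      _ = 2 * a := by field_simp; ring

theorem ncard_image_le_exp_mul_of_norm_apply_sub_le {κ Φ Y : Type*} [Fintype κ] [Finite Y]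
    (P : Set Φ) (p : Φ → Y) (u : Φ → κ → E) (B : Y → Set Y) {R a N : ℝ} (hR : 0 < R) (ha : 0 < a)
    (hN₀ : 0 ≤ N) (hu : ∀ φ ∈ P, ∀ k, ‖u φ k‖ ≤ R) (hA : ∀ φ ∈ P, ∀ k, ‖A (u φ k) - u φ k‖ ≤ a)
    (hB : ∀ φ ∈ P, ∀ ψ ∈ P, (∀ k, ‖u φ k - u ψ k‖ ≤ 8 * a) → p φ ∈ B (p ψ))
    (hN : ∀ y, ((B y).ncard : ℝ) ≤ N) :
    ((p '' P).ncard : ℝ) ≤ Real.exp (2 * Fintype.card κ * ((R / a) ^ 2 *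
      ∑ l, ‖A (e l)‖ ^ 2) * Real.log (2 + R / (2 * a))) * N := by
  obtain ⟨W, hWrank, hW⟩ := exists_submodule_near_of_norm_apply_sub_le e A hR ha
  choose! w hw using hW
  have hnear : ∀ φ ∈ P, ∀ k, ‖(w (u φ k) : E) - u φ k‖ ≤ 2 * a :=
    fun φ hφ k => hw _ (hu φ hφ k) (hA φ hφ k)
  have hbound : ∀ φ ∈ P, ‖fun k => w (u φ k)‖ ≤ R + 2 * a := fun φ hφ =>
    (pi_norm_le_iff_of_nonneg (by positivity)).2 fun k => by
      have htri := norm_le_norm_add_norm_sub' (w (u φ k) : E) (u φ k)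
      rw [Submodule.coe_norm]
      linarith [hu φ hφ k, hnear φ hφ k]
  have hsep : ∀ φ ∈ P, ∀ ψ ∈ P,
      ‖(fun k => w (u φ k)) - fun k => w (u ψ k)‖ ≤ 4 * a → p φ ∈ B (p ψ) :=
    fun φ hφ ψ hψ hφψ => hB φ hφ ψ hψ fun k => by
      have hk : ‖(w (u φ k) : E) - w (u ψ k)‖ ≤ 4 * a := (norm_le_pi_norm _ k).trans hφψ
      have hφk := hnear φ hφ k
      have hψk := hnear ψ hψ k
      have htri := dist_triangle4 (u φ k) (w (u φ k) : E) (w (u ψ k)) (u ψ k)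
      rw [← dist_eq_norm] at hk hφk hψk ⊢
      rw [dist_comm (u φ k) (w _ : E)] at htri
      linarith
  have hrank : (Module.finrank ℝ (κ → W) : ℝ) ≤
      2 * Fintype.card κ * ((R / a) ^ 2 * ∑ l, ‖A (e l)‖ ^ 2) := by
    rw [Module.finrank_pi_fintype, finrank_real_of_complex, Finset.sum_const, Finset.card_univ,
      smul_eq_mul, ← mul_assoc, mul_comm (Fintype.card κ)]
    push_cast
    gcongr
  have hbase : 1 + 2 * (R + 2 * a) / (4 * a) = 2 + R / (2 * a) := by
    field_simp
    ring
  have hlog : 0 ≤ Real.log (2 + R / (2 * a)) :=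
    Real.log_nonneg (by linarith [show 0 ≤ R / (2 * a) by positivity])
  refine (ncard_image_le_pow_finrank_mul P p _ B (by positivity) (by positivity) hN₀ hbound hsep
    hN).trans ?_
  rw [hbase, ← Real.rpow_natCast, Real.rpow_def_of_pos (by positivity), mul_comm (Real.log _)]
  gcongr

end AlmostFixed

/-! ### Observables determined by a subspace of `L²` -/

section ApproxDetermined

variable {X : Type*} [MeasurableSpace X] {μ : Measure X}

/-- The map `α` is determined, off sets of arbitrarily small measure, by the approximate values of
finitely many functions in `H`. -/
def ApproxDetermined (H : Submodule ℂ (Lp ℂ 2 μ)) {A : Type*} (α : X → A) : Prop :=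
  ∀ η : ℝ≥0∞, η ≠ 0 → ∃ s : Finset H, ∃ r : ℝ, 0 < r ∧ ∃ bad : Set X, μ bad ≤ η ∧
    ∀ x ∉ bad, ∀ y ∉ bad, (∀ f ∈ s, ‖f.1 x - f.1 y‖ < r) → α x = α y

namespace ApproxDetermined

variable {H : Submodule ℂ (Lp ℂ 2 μ)} {A A' : Type*}

theorem of_factorsThrough {α : X → A} (hα : ApproxDetermined H α) {α' : X → A'}
    (h : α'.FactorsThrough α) : ApproxDetermined H α' := fun η hη =>
  let ⟨s, r, hr, bad, hbad, hs⟩ := hα η hη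
  ⟨s, r, hr, bad, hbad, fun x hx y hy hxy => h (hs x hx y hy hxy)⟩

theorem of_forall_exists_measure_ne_le {α : X → A}
    (h : ∀ η : ℝ≥0∞, η ≠ 0 → ∃ α' : X → A, ApproxDetermined H α' ∧ μ {x | α x ≠ α' x} ≤ η) :
    ApproxDetermined H α := fun η hη => by
  have hη₂ : η / 2 ≠ 0 := by simpa using hη
  obtain ⟨α', hα', hne⟩ := h _ hη₂
  obtain ⟨s, r, hr, bad, hbad, hs⟩ := hα' _ hη₂
  refine ⟨s, r, hr, bad ∪ {x | α x ≠ α' x}, ?_, fun x hx y hy hxy => ?_⟩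
  · calc μ (bad ∪ {x | α x ≠ α' x}) ≤ μ bad + μ {x | α x ≠ α' x} := measure_union_le _ _
      _ ≤ η / 2 + η / 2 := add_le_add hbad hne
      _ = η := ENNReal.add_halves η
  · simp only [Set.mem_union, Set.mem_ofPred_eq, not_or, not_not] at hx hy
    rw [hx.2, hy.2, hs x hx.1 y hy.1 hxy]

theorem congr {α α' : X → A} (hα : ApproxDetermined H α) (h : α' =ᵐ[μ] α) :
    ApproxDetermined H α' :=
  of_forall_exists_measure_ne_le fun _ _ => ⟨α, hα, (ae_iff.1 h).trans_le zero_le⟩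

theorem pi {ι : Type*} [Finite ι] {α : ι → X → A} (hα : ∀ i, ApproxDetermined H (α i)) :
    ApproxDetermined H fun x i => α i x := fun η hη => by
  classical
  have := Fintype.ofFinite ι
  obtain ⟨η', hη'pos, hη'⟩ := ENNReal.exists_pos_sum_of_countable' hη ι
  choose s r hr bad hbad hs using fun i => hα i (η' i) (hη'pos i).ne'
  obtain ⟨r', hr'pos, hr'⟩ : ∃ r' > 0, ∀ i, r' < r i := by
    have hev : ∀ᶠ r' in 𝓝[>] (0 : ℝ), ∀ i, r' < r i :=
      eventually_all.2 fun i => eventually_nhdsWithin_of_eventually_nhds (eventually_lt_nhds (hr i))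
    exact (eventually_mem_nhdsWithin.and hev).exists
  refine ⟨Finset.univ.biUnion s, r', hr'pos, ⋃ i, bad i, ?_,
    fun x hx y hy hxy => funext fun i => ?_⟩
  · calc μ (⋃ i, bad i) ≤ ∑' i, μ (bad i) := measure_iUnion_le _
      _ ≤ ∑' i, η' i := ENNReal.tsum_le_tsum hbad
      _ ≤ η := hη'.le
  · rw [Set.mem_iUnion, not_exists] at hx hy
    exact hs i x (hx i) y (hy i) fun f hf =>
      (hxy f (Finset.mem_biUnion.2 ⟨i, Finset.mem_univ i, hf⟩)).trans (hr' i)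

theorem iUnion [IsFiniteMeasure μ] {E : ℕ → Set X} (hm : ∀ i, MeasurableSet (E i))
    (hE : ∀ i, ApproxDetermined H (· ∈ E i)) : ApproxDetermined H (· ∈ ⋃ i, E i) := by
  have hlim : Tendsto (fun N => μ ((⋃ i, E i) \ Set.accumulate E N)) atTop (𝓝 0) := by
    have hempty : ⋂ N, (⋃ i, E i) \ Set.accumulate E N = ∅ := by
      rw [← Set.sdiff_iUnion, Set.iUnion_accumulate, Set.sdiff_self]
    rw [← measure_empty (μ := μ), ← hempty]
    exact tendsto_measure_iInter_atTop
      (fun N => ((MeasurableSet.iUnion hm).diff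
        (.biUnion (Set.to_countable _) fun i _ => hm i)).nullMeasurableSet)
      (fun M N hMN => Set.sdiff_subset_sdiff_right (Set.monotone_accumulate hMN))
      ⟨0, measure_ne_top _ _⟩
  refine of_forall_exists_measure_ne_le fun η hη => ?_
  obtain ⟨N, hN⟩ := (hlim.eventually (gt_mem_nhds (pos_iff_ne_zero.2 hη))).exists
  refine ⟨(· ∈ Set.accumulate E N), ?_, (measure_mono fun x hx => ?_).trans hN.le⟩
  · refine (pi fun i : Set.Iic N => hE i).of_factorsThrough fun x y hxy => ?_
    simp only [Set.mem_accumulate]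
    exact propext (exists_congr fun i => and_congr_right fun hi =>
      Iff.of_eq (congr_fun hxy ⟨i, hi⟩))
  · by_contra hxN
    refine hx (propext ⟨fun h => ?_, fun h => Set.accumulate_subset_iUnion N h⟩)
    by_contra hc
    exact hxN ⟨h, hc⟩

theorem mem_preimage [IsFiniteMeasure μ] {f : Lp ℂ 2 μ} (hf : f ∈ H) {S : Set ℂ}
    (hS : MeasurableSet S) : ApproxDetermined H fun x => f x ∈ S := fun η hη => by
  have hη₂ : η / 2 ≠ 0 := by simpa using hη
  have hfm : Measurable (f : X → ℂ) := (Lp.stronglyMeasurable f).measurable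
  obtain ⟨K, hKS, hK, hμK⟩ := hS.exists_isCompact_sdiff_lt (μ := μ.map f) (measure_ne_top _ _) hη₂
  obtain ⟨L, hLS, hL, hμL⟩ :=
    hS.compl.exists_isCompact_sdiff_lt (μ := μ.map f) (measure_ne_top _ _) hη₂
  obtain ⟨r, hr, hsep⟩ := Metric.exists_pos_forall_lt_edist hK hL.isClosed
    (disjoint_compl_right.mono hKS hLS)
  have hsep' {z w : ℂ} (hz : z ∈ K) (hw : w ∈ L) : ¬ ‖z - w‖ < r := fun hlt =>
    (hsep z hz w hw).not_ge <| by
      rw [edist_dist, dist_eq_norm]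
      exact ENNReal.ofReal_le_of_le_toReal hlt.le
  refine ⟨{⟨f, hf⟩}, r, NNReal.coe_pos.2 hr, f ⁻¹' (S \ K) ∪ f ⁻¹' (Sᶜ \ L), ?_,
    fun x hx y hy hxy => ?_⟩
  · rw [Measure.map_apply hfm (hS.diff hK.measurableSet)] at hμK
    rw [Measure.map_apply hfm (hS.compl.diff hL.measurableSet)] at hμL
    calc _ ≤ _ := measure_union_le _ _
      _ ≤ η / 2 + η / 2 := add_le_add hμK.le hμL.le
      _ = η := ENNReal.add_halves η
  · have hlt := hxy _ (Finset.mem_singleton_self _)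
    simp only [Set.mem_union, Set.mem_preimage, Set.mem_sdiff, Set.mem_compl_iff, not_or, not_and,
      not_not] at hx hy
    refine propext ⟨fun h => ?_, fun h => ?_⟩ <;> by_contra hc
    · exact hsep' (hx.1 h) (hy.2 hc) hlt
    · exact hsep' (hy.1 h) (hx.2 hc) (norm_sub_rev (f x) (f y) ▸ hlt)

end ApproxDetermined

end ApproxDetermined

section Generation

variable {Γ : Type*} [Group Γ] {X : Type*} [MeasurableSpace X] [MulAction Γ X]
  [MeasurableConstSMul Γ X] {μ : Measure X} [SMulInvariantMeasure Γ X μ]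

theorem coeFn_koopman (g : Γ) (f : Lp ℂ 2 μ) : koopman Γ μ g f =ᵐ[μ] fun x => f (g⁻¹ • x) :=
  Lp.coeFn_compMeasurePreserving f (measurePreserving_smul g⁻¹ μ)

variable [IsFiniteMeasure μ] {H : Submodule ℂ (Lp ℂ 2 μ)}

theorem Generates.approxDetermined_mem (hgen : Generates Γ H) (hH : (koopman Γ μ).IsSubrep H)
    {E : Set X} (hE : MeasurableSet E) : ApproxDetermined H (· ∈ E) := by
  obtain ⟨E', hE', hEE'⟩ := hgen E hE
  refine ApproxDetermined.congr ?_ hEE'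
  suffices h : MeasurableSet E' ∧ ApproxDetermined H (· ∈ E') from h.2
  refine MeasurableSpace.generateFrom_induction
    (p := fun E _ => MeasurableSet E ∧ ApproxDetermined H (· ∈ E)) _ ?_ ?_ ?_ ?_ E' hE'
  · rintro _ ⟨g, f, S, hf, hS, rfl⟩ _
    have htranslate : (fun x => g • x) '' (f ⁻¹' S) = {x | f (g⁻¹ • x) ∈ S} :=
      (Set.preimage_smul_inv g _).symm
    rw [htranslate]
    refine ⟨((Lp.stronglyMeasurable f).measurable.comp (measurable_const_smul g⁻¹)) hS,
      (ApproxDetermined.mem_preimage (hH.2 g f hf) hS).congr ?_⟩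
    filter_upwards [coeFn_koopman g f] with x hx
    rw [hx]
  · exact ⟨MeasurableSet.empty, fun η _ => ⟨∅, 1, one_pos, ∅, by simp, fun _ _ _ _ _ => rfl⟩⟩
  · rintro E _ ⟨hm, h⟩
    exact ⟨hm.compl, h.of_factorsThrough fun _ _ hxy => congrArg Not hxy⟩
  · intro E _ h
    exact ⟨.iUnion fun i => (h i).1, .iUnion (fun i => (h i).1) fun i => (h i).2⟩

theorem Generates.approxDetermined (hgen : Generates Γ H) (hH : (koopman Γ μ).IsSubrep H)
    {A : Type*} [Finite A] [MeasurableSpace A] [MeasurableSingletonClass A] {α : X → A}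
    (hα : Measurable α) : ApproxDetermined H α :=
  (ApproxDetermined.pi fun a =>
    hgen.approxDetermined_mem hH (hα (measurableSet_singleton a))).of_factorsThrough
      fun x _ hxy => ((congr_fun hxy (α x)).mp rfl).symm

end Generation

/-! ### Finite models -/

section UnifProb

variable {d : ℕ}

theorem unifProb_mul_eq_card (P : Fin d → Prop) [DecidablePred P] :
    unifProb d P * d = (Finset.univ.filter P).card := by
  rw [unifProb, ← Set.ncard_coe_finset, Finset.coe_filter_univ]
  rcases Nat.eq_zero_or_pos d with rfl | hd
  · simp [Set.eq_empty_of_isEmpty]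
  · field_simp

theorem unifProb_nonneg (P : Fin d → Prop) : 0 ≤ unifProb d P := by
  unfold unifProb
  positivity

theorem unifProb_not (hd : 0 < d) (P : Fin d → Prop) :
    unifProb d (fun j => ¬ P j) = 1 - unifProb d P := by
  have h := Set.ncard_add_ncard_compl {j | P j}
  rw [Nat.card_eq_fintype_card, Fintype.card_fin] at h
  rw [unifProb, unifProb, eq_sub_iff_add_eq, ← add_div, div_eq_one_iff_eq (by positivity),
    add_comm]
  exact_mod_cast h

theorem unifProb_exists_le {ι : Type*} (s : Finset ι) (P : ι → Fin d → Prop) :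
    unifProb d (fun j => ∃ i ∈ s, P i j) ≤ ∑ i ∈ s, unifProb d (P i) := by
  simp only [unifProb, ← Finset.sum_div]
  gcongr
  have hunion : {j | ∃ i ∈ s, P i j} = ⋃ i ∈ s, {j | P i j} := by
    ext j
    simp
  rw [hunion]
  exact_mod_cast s.set_ncard_biUnion_le _

end UnifProb

section ShiftOp

variable {Γ ι : Type*} [Fintype ι]

/-- The operator `∑ g, c g • σ(g)` on `ℓ²(ι)` that an element `c` of the group ring `ℂΓ` induces
through a map `σ` to the permutations of `ι`. -/
noncomputable def shiftOp (σ : Γ → Equiv.Perm ι) (c : Γ →₀ ℂ) :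
    EuclideanSpace ℂ ι →L[ℂ] EuclideanSpace ℂ ι :=
  UnitaryRep.linearExtension (fun g => LinearIsometryEquiv.piLpCongrLeft 2 ℂ ℂ (σ g)) c

theorem shiftOp_apply (σ : Γ → Equiv.Perm ι) (c : Γ →₀ ℂ) (v : EuclideanSpace ℂ ι) (j : ι) :
    shiftOp σ c v j = ∑ g ∈ c.support, c g * v ((σ g)⁻¹ j) := by
  rw [shiftOp, UnitaryRep.linearExtension_apply, WithLp.ofLp_sum, Finset.sum_apply]
  rfl

theorem norm_sq_shiftOp_single_of_injOn [DecidableEq ι] {σ : Γ → Equiv.Perm ι} {c : Γ →₀ ℂ}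
    {l : ι} (hl : Set.InjOn (fun g => σ g l) c.support) :
    ‖shiftOp σ c (EuclideanSpace.single l 1)‖ ^ 2 = ∑ g ∈ c.support, ‖c g‖ ^ 2 := by
  have hsum : shiftOp σ c (EuclideanSpace.single l 1) =
      ∑ g ∈ c.support, EuclideanSpace.single (σ g l) (c g) := by
    rw [shiftOp, UnitaryRep.linearExtension_apply]
    refine Finset.sum_congr rfl fun g _ => ?_
    ext j
    simp [EuclideanSpace.single, LinearIsometryEquiv.piLpCongrLeft_single]
  rw [hsum, norm_sum_sq_of_pairwise_inner_eq_zero (𝕜 := ℂ)]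
  · simp only [PiLp.norm_single]
  · intro g hg h hh hgh
    simp [EuclideanSpace.inner_single_left, hl.ne hg hh hgh]

theorem sum_norm_sq_shiftOp_le {d : ℕ} (σ : Γ → Equiv.Perm (Fin d)) (c : Γ →₀ ℂ) :
    ∑ l, ‖shiftOp σ c (EuclideanSpace.basisFun (Fin d) ℂ l)‖ ^ 2 ≤
      (∑ g ∈ c.support, ‖c g‖ ^ 2 + (∑ g ∈ c.support, ‖c g‖) ^ 2 *
        unifProb d fun l => ¬ Set.InjOn (fun g => σ g l) c.support) * d := by
  classical
  have hterm : ∀ l, ‖shiftOp σ c (EuclideanSpace.basisFun (Fin d) ℂ l)‖ ^ 2 ≤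
      ∑ g ∈ c.support, ‖c g‖ ^ 2 + (∑ g ∈ c.support, ‖c g‖) ^ 2 *
        (if ¬ Set.InjOn (fun g => σ g l) c.support then 1 else 0) := fun l => by
    rw [EuclideanSpace.basisFun_apply]
    split_ifs with hl
    · rw [norm_sq_shiftOp_single_of_injOn hl, mul_zero, add_zero]
    · have hnorm := UnitaryRep.norm_linearExtension_apply_le
        (fun g => LinearIsometryEquiv.piLpCongrLeft 2 ℂ ℂ (σ g)) c (EuclideanSpace.single l 1)
      rw [PiLp.norm_single, norm_one, mul_one] at hnorm
      rw [mul_one]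
      exact (pow_le_pow_left₀ (norm_nonneg _) hnorm 2).trans
        (le_add_of_nonneg_left (by positivity))
  refine (Finset.sum_le_sum fun l _ => hterm l).trans_eq ?_
  rw [Finset.sum_add_distrib, ← Finset.mul_sum, Finset.sum_boole, ← unifProb_mul_eq_card,
    Finset.sum_const, Finset.card_univ, Fintype.card_fin, nsmul_eq_mul]
  ring

end ShiftOp

namespace SoficApproximation

variable {Γ : Type*} [Group Γ] (Sg : SoficApproximation Γ)

theorem tendsto_unifProb_not_injOn (F : Finset Γ) :
    Tendsto (fun i => unifProb (Sg.d i) fun l => ¬ Set.InjOn (fun g => Sg.σ i g l) F)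
      atTop (𝓝 0) := by
  classical
  have hlim : Tendsto (fun i => ∑ p ∈ F.offDiag,
      (1 - unifProb (Sg.d i) fun k => Sg.σ i p.1 k ≠ Sg.σ i p.2 k)) atTop (𝓝 0) := by
    have hsum := tendsto_finsetSum F.offDiag fun p hp =>
      (Sg.tendsto_ne p.1 p.2 (Finset.mem_offDiag.1 hp).2.2).const_sub 1
    simpa only [sub_self, Finset.sum_const_zero] using hsum
  refine tendsto_of_tendsto_of_tendsto_of_le_of_le tendsto_const_nhds hlim
    (fun i => unifProb_nonneg _) fun i => ?_
  have hcollision : (fun l => ¬ Set.InjOn (fun g => Sg.σ i g l) F) =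
      fun l => ∃ p ∈ F.offDiag, ¬ (Sg.σ i p.1 l ≠ Sg.σ i p.2 l) := by
    funext l
    simp only [Set.InjOn, not_forall, Finset.mem_offDiag, not_not, Prod.exists, Finset.mem_coe,
      eq_iff_iff]
    grind
  rw [hcollision]
  exact (unifProb_exists_le _ _).trans_eq
    (Finset.sum_congr rfl fun p _ => unifProb_not (Sg.d_pos i) _)

theorem eventually_sum_norm_sq_shiftOp_le {c : Γ →₀ ℂ} {τ : ℝ}
    (hc : ∑ g ∈ c.support, ‖c g‖ ^ 2 < τ) :
    ∀ᶠ i in atTop, ∑ l, ‖shiftOp (Sg.σ i) c (EuclideanSpace.basisFun _ ℂ l)‖ ^ 2 ≤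
      τ * Sg.d i := by
  have hlim := ((Sg.tendsto_unifProb_not_injOn c.support).const_mul
    ((∑ g ∈ c.support, ‖c g‖) ^ 2)).const_add (∑ g ∈ c.support, ‖c g‖ ^ 2)
  rw [mul_zero, add_zero] at hlim
  filter_upwards [hlim.eventually (gt_mem_nhds hc)] with i hi
  exact (sum_norm_sq_shiftOp_le _ _).trans (by gcongr)

end SoficApproximation

/-! ### Approximate microstates -/

section Microstates

variable {Γ : Type*} [Group Γ] {X : Type*} [MeasurableSpace X] {μ : Measure X} {B : Type*}
  {β : X → B} {F : Finset Γ} {hF : 1 ∈ F} {d : ℕ} {σ : Γ → Equiv.Perm (Fin d)} {φ : Fin d → F → B}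

theorem L2_norm_sq_eq_integral (f : Lp ℂ 2 μ) : ‖f‖ ^ 2 = ∫ x, ‖f x‖ ^ 2 ∂μ := by
  rw [← inner_self_eq_norm_sq (𝕜 := ℂ), L2.inner_def, ← integral_re (L2.integrable_inner f f)]
  simp only [inner_self_eq_norm_sq]

/-- The vector of values of a function `θ` on the alphabet along the microstate `φ`. -/
noncomputable def microVec (hF : 1 ∈ F) (θ : B → ℂ) (φ : Fin d → F → B) :
    EuclideanSpace ℂ (Fin d) :=
  WithLp.toLp 2 fun j => θ (φ j ⟨1, hF⟩)

/-- The local rule computing the coordinates of `shiftOp σ c v - v` for a microstate vector `v`: its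
arguments are the letters seen in the directions `F` and the letter at the base point. -/
noncomputable def localDefect (F : Finset Γ) (c : Γ →₀ ℂ) (θ : B → ℂ) (p : (F → B) × B) : ℂ :=
  ∑ g : F, c g * θ (p.1 g) - θ p.2

theorem shiftOp_microVec_sub_apply {c : Γ →₀ ℂ} (hc : c.support ⊆ F) (θ : B → ℂ) (j : Fin d) :
    (shiftOp σ c (microVec hF θ φ) - microVec hF θ φ) j =
      localDefect F c θ (fun g => φ ((σ g)⁻¹ j) ⟨1, hF⟩, φ j ⟨1, hF⟩) := by
  rw [PiLp.sub_apply, shiftOp_apply, localDefect]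
  congr 1
  rw [Finset.sum_coe_sort F fun g => c g * θ (φ ((σ g)⁻¹ j) ⟨1, hF⟩)]
  exact Finset.sum_subset hc fun g _ hg => by rw [Finsupp.notMem_support_iff.1 hg, zero_mul]

theorem linearExtension_koopman_sub_ae_eq [MulAction Γ X] [MeasurableConstSMul Γ X]
    [SMulInvariantMeasure Γ X μ] {c : Γ →₀ ℂ} (hc : c.support ⊆ F) {θ : B → ℂ}
    {f : Lp ℂ 2 μ} (hf : f =ᵐ[μ] θ ∘ β) :
    UnitaryRep.linearExtension (koopman Γ μ) c f - f =ᵐ[μ]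
      fun x => localDefect F c θ (fun g => β ((g : Γ)⁻¹ • x), β ((1 : Γ)⁻¹ • x)) := by
  have hsmul : ∀ᵐ x ∂μ, ∀ g ∈ c.support,
      (c g • koopman Γ μ g f : Lp ℂ 2 μ) x = c g * θ (β (g⁻¹ • x)) := by
    refine (Finset.eventually_all _).2 fun g _ => ?_
    filter_upwards [Lp.coeFn_smul (c g) (koopman Γ μ g f), coeFn_koopman g f,
      (measurePreserving_smul g⁻¹ μ).quasiMeasurePreserving.ae_eq_comp hf] with x h₁ h₂ h₃
    rw [h₁, Pi.smul_apply, h₂, smul_eq_mul]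
    exact congrArg (c g * ·) h₃
  rw [UnitaryRep.linearExtension_apply]
  filter_upwards [Lp.coeFn_sub (∑ g ∈ c.support, c g • koopman Γ μ g f) f,
    Lp.coeFn_finsetSum c.support fun g => c g • koopman Γ μ g f, hsmul, hf] with x h₁ h₂ h₃ h₄
  rw [h₁, Pi.sub_apply, h₂, Finset.sum_apply, Finset.sum_congr rfl h₃, h₄, localDefect, inv_one,
    one_smul, Finset.sum_coe_sort F fun g => c g * θ (β (g⁻¹ • x))]
  congr 1
  exact Finset.sum_subset hc fun g _ hg => by rw [Finsupp.notMem_support_iff.1 hg, zero_mul]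

variable [MulAction Γ X] [MeasurableConstSMul Γ X] [MeasurableSpace B] [MeasurableSingletonClass B]

theorem integral_itinerary [IsFiniteMeasure μ] (hβ : Measurable β) (F : Finset Γ)
    [Fintype (F → B)] (G : (F → B) → ℝ) :
    ∫ x, G (fun g => β ((g : Γ)⁻¹ • x)) ∂μ =
      ∑ a : F → B, μ.real {x | ∀ g : F, β ((g : Γ)⁻¹ • x) = a g} * G a := by
  have hitin : Measurable fun (x : X) (g : F) => β ((g : Γ)⁻¹ • x) :=
    measurable_pi_iff.2 fun g => hβ.comp (measurable_const_smul _)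
  rw [← integral_map (f := G) hitin.aemeasurable (measurable_of_finite G).aestronglyMeasurable,
    integral_fintype .of_finite]
  refine Finset.sum_congr rfl fun a _ => ?_
  rw [smul_eq_mul, map_measureReal_apply hitin (measurableSet_singleton a)]
  congr 2
  ext x
  exact funext_iff

variable [IsFiniteMeasure μ] [Fintype B] {δ : ℝ}

theorem sum_le_of_mem_AP (hβ : Measurable β) (hφ : φ ∈ AP μ β F hF δ σ) (G : (F → B) → ℝ) {C : ℝ}
    (hC : 0 ≤ C) (hG : ∀ a, |G a| ≤ C) :
    ∑ j, G (φ j) ≤ d * (∫ x, G (fun g => β ((g : Γ)⁻¹ • x)) ∂μ + C * δ) := by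
  classical
  have hsum : ∑ j, G (φ j) = d * ∑ a, unifProb d (fun j => φ j = a) * G a := by
    rw [Finset.mul_sum, ← Finset.sum_fiberwise Finset.univ φ]
    refine Finset.sum_congr rfl fun a _ => ?_
    rw [← mul_assoc, mul_comm (d : ℝ), unifProb_mul_eq_card, ← nsmul_eq_mul, ← Finset.sum_const]
    exact Finset.sum_congr rfl fun j hj => by rw [(Finset.mem_filter.1 hj).2]
  rw [hsum, integral_itinerary hβ]
  gcongr
  rw [← sub_le_iff_le_add', ← Finset.sum_sub_distrib]
  calc ∑ a, (unifProb d (fun j => φ j = a) * G a -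
        μ.real {x | ∀ g : F, β ((g : Γ)⁻¹ • x) = a g} * G a)
    _ ≤ ∑ a, C * |unifProb d (fun j => φ j = a) -
        μ.real {x | ∀ g : F, β ((g : Γ)⁻¹ • x) = a g}| := Finset.sum_le_sum fun a _ => by
      rw [← sub_mul, mul_comm C]
      refine (le_abs_self _).trans ?_
      rw [abs_mul]
      gcongr
      exact hG a
    _ ≤ C * δ := by
      rw [← Finset.mul_sum]
      exact mul_le_mul_of_nonneg_left hφ.1.le hC

theorem card_filter_mem_le_of_mem_AP (hβ : Measurable β) (hφ : φ ∈ AP μ β F hF δ σ) (N : Set B)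
    [DecidablePred (· ∈ N)] :
    ((Finset.univ.filter fun j => φ j ⟨1, hF⟩ ∈ N).card : ℝ) ≤ d * (μ.real (β ⁻¹' N) + δ) := by
  have h := sum_le_of_mem_AP hβ hφ (fun a => N.indicator 1 (a ⟨1, hF⟩)) zero_le_one fun a => by
    by_cases ha : a ⟨1, hF⟩ ∈ N <;> simp [ha]
  have hint : ∫ x, N.indicator (1 : B → ℝ) (β ((1 : Γ)⁻¹ • x)) ∂μ = μ.real (β ⁻¹' N) := by
    rw [← integral_indicator_one (hβ .of_discrete)]
    simp only [inv_one, one_smul]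
    rfl
  rw [hint, one_mul] at h
  simpa only [Set.indicator_apply, Pi.one_apply, Finset.sum_boole] using h

theorem sum_norm_sq_le_of_mem_AP (hβ : Measurable β) (hφ : φ ∈ AP μ β F hF δ σ) {w : (F → B) → ℂ}
    {f : Lp ℂ 2 μ} (hf : f =ᵐ[μ] fun x => w fun g => β ((g : Γ)⁻¹ • x)) {C : ℝ}
    (hw : ∀ a, ‖w a‖ ≤ C) : ∑ j, ‖w (φ j)‖ ^ 2 ≤ d * (‖f‖ ^ 2 + C ^ 2 * δ) := by
  have hint : ∫ x, ‖w fun g => β ((g : Γ)⁻¹ • x)‖ ^ 2 ∂μ = ‖f‖ ^ 2 := by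
    rw [L2_norm_sq_eq_integral]
    exact integral_congr_ae (hf.mono fun x hx => by simp only [hx])
  rw [← hint]
  refine sum_le_of_mem_AP hβ hφ (fun a => ‖w a‖ ^ 2) (sq_nonneg C) fun a => ?_
  rw [abs_of_nonneg (sq_nonneg _)]
  exact pow_le_pow_left₀ (norm_nonneg _) (hw a) 2

theorem norm_sq_microVec_le (hβ : Measurable β) (hφ : φ ∈ AP μ β F hF δ σ) {θ : B → ℂ}
    {f : Lp ℂ 2 μ} (hf : f =ᵐ[μ] θ ∘ β) :
    ‖microVec hF θ φ‖ ^ 2 ≤ d * (‖f‖ ^ 2 + ‖θ‖ ^ 2 * δ) := by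
  rw [EuclideanSpace.norm_sq_eq]
  refine sum_norm_sq_le_of_mem_AP hβ hφ (w := fun a => θ (a ⟨1, hF⟩)) ?_
    fun a => norm_le_pi_norm _ _
  simpa only [inv_one, one_smul] using! hf

theorem norm_sq_shiftOp_microVec_sub_le [SMulInvariantMeasure Γ X μ] (hβ : Measurable β)
    (hφ : φ ∈ AP μ β F hF δ σ) {c : Γ →₀ ℂ} (hc : c.support ⊆ F) {θ : B → ℂ} {f : Lp ℂ 2 μ}
    (hf : f =ᵐ[μ] θ ∘ β) {C : ℝ} (hC : ∀ p, ‖localDefect F c θ p‖ ≤ C) :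
    ‖shiftOp σ c (microVec hF θ φ) - microVec hF θ φ‖ ^ 2 ≤
      d * (‖UnitaryRep.linearExtension (koopman Γ μ) c f - f‖ ^ 2 +
        C ^ 2 * (1 + F.card) * δ) := by
  classical
  let w : (F → B) → ℂ := fun a => localDefect F c θ (a, a ⟨1, hF⟩)
  let bad : Fin d → Prop := fun j => ∃ g ∈ F.attach, φ j g ≠ φ ((σ g)⁻¹ j) ⟨1, hF⟩
  have hbad : unifProb d bad ≤ F.card * δ := by
    refine (unifProb_exists_le _ _).trans ?_
    rw [← Finset.card_attach, ← nsmul_eq_mul]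
    exact Finset.sum_le_card_nsmul _ _ _ fun g _ => (hφ.2 g).le
  have hterm : ∀ j, ‖(shiftOp σ c (microVec hF θ φ) - microVec hF θ φ) j‖ ^ 2 ≤
      ‖w (φ j)‖ ^ 2 + C ^ 2 * (if bad j then 1 else 0) := fun j => by
    rw [shiftOp_microVec_sub_apply hc]
    split_ifs with hj
    · rw [mul_one]
      exact (pow_le_pow_left₀ (norm_nonneg _) (hC _) 2).trans
        (le_add_of_nonneg_left (sq_nonneg _))
    · have heq : (fun g : F => φ ((σ g)⁻¹ j) ⟨1, hF⟩) = φ j := by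
        simp only [bad, not_exists, not_and, not_not, Finset.mem_attach, true_imp_iff] at hj
        exact funext fun g => (hj g).symm
      rw [heq, mul_zero, add_zero]
  have hgood := sum_norm_sq_le_of_mem_AP hβ hφ (w := w) (linearExtension_koopman_sub_ae_eq hc hf)
    fun a => hC _
  rw [EuclideanSpace.norm_sq_eq]
  calc ∑ j, ‖(shiftOp σ c (microVec hF θ φ) - microVec hF θ φ) j‖ ^ 2
    _ ≤ ∑ j, ‖w (φ j)‖ ^ 2 + C ^ 2 * (unifProb d bad * d) := by
      rw [unifProb_mul_eq_card, ← Finset.sum_boole, Finset.mul_sum, ← Finset.sum_add_distrib]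
      exact Finset.sum_le_sum fun j _ => hterm j
    _ ≤ d * (‖UnitaryRep.linearExtension (koopman Γ μ) c f - f‖ ^ 2 +
        C ^ 2 * δ) + C ^ 2 * (F.card * δ * d) := by
      gcongr
    _ = _ := by ring

end Microstates

/-! ### Counting colorings -/

theorem hammingDist_comp_le_of_separating {ι κ A B : Type*} [Fintype ι] [Fintype κ] [DecidableEq A]
    {π : B → A} {θ : κ → B → ℂ} {N : Set B} [DecidablePred (· ∈ N)] {r : ℝ} (hr : 0 < r)
    (hsep : ∀ b ∉ N, ∀ b' ∉ N, (∀ k, ‖θ k b - θ k b'‖ < r) → π b = π b') (u u' : ι → B) {t : ℝ}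
    (ht : ∀ k, ∑ j, ‖θ k (u j) - θ k (u' j)‖ ^ 2 ≤ t) :
    (hammingDist (fun j => π (u j)) (fun j => π (u' j)) : ℝ) ≤
      (Finset.univ.filter (u · ∈ N)).card + (Finset.univ.filter (u' · ∈ N)).card +
        Fintype.card κ * (t / r ^ 2) := by
  classical
  let far : κ → Finset ι := fun k => Finset.univ.filter fun j => r ≤ ‖θ k (u j) - θ k (u' j)‖
  have hfar : ∀ k, ((far k).card : ℝ) ≤ t / r ^ 2 := fun k => by
    rw [le_div_iff₀ (by positivity), ← nsmul_eq_mul]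
    exact (Finset.card_nsmul_le_sum _ (fun j => ‖θ k (u j) - θ k (u' j)‖ ^ 2) _ fun j hj =>
      pow_le_pow_left₀ hr.le (Finset.mem_filter.1 hj).2 2).trans
        ((Finset.sum_le_univ_sum_of_nonneg fun _ => sq_nonneg _).trans (ht k))
  have hsub : (Finset.univ.filter fun j => π (u j) ≠ π (u' j)) ⊆
      Finset.univ.filter (u · ∈ N) ∪ Finset.univ.filter (u' · ∈ N) ∪ Finset.univ.biUnion far := by
    intro j hj
    simp only [far, Finset.mem_union, Finset.mem_filter_univ, Finset.mem_biUnion, Finset.mem_univ,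
      true_and]
    by_contra! hcon
    exact (Finset.mem_filter.1 hj).2 (hsep _ hcon.1.1 _ hcon.1.2 hcon.2)
  have hcard : hammingDist (fun j => π (u j)) (fun j => π (u' j)) ≤
      (Finset.univ.filter (u · ∈ N)).card + (Finset.univ.filter (u' · ∈ N)).card +
        ∑ k, (far k).card :=
    (Finset.card_le_card hsub).trans ((Finset.card_union_le _ _).trans
      (add_le_add (Finset.card_union_le _ _) Finset.card_biUnion_le))
  refine (Nat.cast_le.2 hcard).trans ?_
  push_cast
  gcongr
  exact (Finset.sum_le_card_nsmul _ _ _ fun k _ => hfar k).trans_eq (nsmul_eq_mul _ _)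

theorem eventually_le_mul_sqrt {x a : ℝ} (hx : 0 ≤ x) (hxa : x < a) (K : ℝ) :
    ∀ᶠ δ in 𝓝 (0 : ℝ), ∀ (d : ℕ) (y : ℝ), y ^ 2 ≤ d * (x ^ 2 + K * δ) → y ≤ a * √d := by
  have hlim : Tendsto (fun δ : ℝ => x ^ 2 + K * δ) (𝓝 0) (𝓝 (x ^ 2)) :=
    (by fun_prop : Continuous fun δ : ℝ => x ^ 2 + K * δ).tendsto' 0 _ (by ring)
  filter_upwards [hlim.eventually (gt_mem_nhds (pow_lt_pow_left₀ hxa hx two_ne_zero))]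
    with δ hδ d y hy
  refine le_of_sq_le_sq ?_ (mul_nonneg (hx.trans hxa.le) (Real.sqrt_nonneg _))
  calc y ^ 2 ≤ d * (x ^ 2 + K * δ) := hy
    _ ≤ d * a ^ 2 := by gcongr
    _ = (a * √d) ^ 2 := by rw [mul_pow, Real.sq_sqrt d.cast_nonneg, mul_comm]

section Colorings

variable {Γ : Type*} [Group Γ] {X : Type*} [MeasurableSpace X] [MulAction Γ X]
  [MeasurableConstSMul Γ X] {μ : Measure X} [IsFiniteMeasure μ] {A B κ : Type*}
  [DecidableEq A] [Fintype B] [MeasurableSpace B]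
  [MeasurableSingletonClass B] [Fintype κ] {β : X → B} {F : Finset Γ}

theorem eventually_norm_microVec_le (hβ : Measurable β) (hF : 1 ∈ F) {θ : B → ℂ} {f : Lp ℂ 2 μ}
    (hf : f =ᵐ[μ] θ ∘ β) {R : ℝ} (hR : ‖f‖ < R) :
    ∀ᶠ δ in 𝓝 (0 : ℝ), ∀ (d : ℕ) (σ : Γ → Equiv.Perm (Fin d)), ∀ φ ∈ AP μ β F hF δ σ,
      ‖microVec hF θ φ‖ ≤ R * √d := by
  filter_upwards [eventually_le_mul_sqrt (norm_nonneg f) hR (‖θ‖ ^ 2)] with δ hδ d σ φ hφ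
  exact hδ d _ (norm_sq_microVec_le hβ hφ hf)

theorem eventually_norm_shiftOp_microVec_sub_le [SMulInvariantMeasure Γ X μ] (hβ : Measurable β)
    (hF : 1 ∈ F) {c : Γ →₀ ℂ} (hc : c.support ⊆ F) {θ : B → ℂ} {f : Lp ℂ 2 μ}
    (hf : f =ᵐ[μ] θ ∘ β) {a : ℝ} (ha : ‖UnitaryRep.linearExtension (koopman Γ μ) c f - f‖ < a) :
    ∀ᶠ δ in 𝓝 (0 : ℝ), ∀ (d : ℕ) (σ : Γ → Equiv.Perm (Fin d)), ∀ φ ∈ AP μ β F hF δ σ,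
      ‖shiftOp σ c (microVec hF θ φ) - microVec hF θ φ‖ ≤ a * √d := by
  obtain ⟨C, hC⟩ := (Set.finite_range fun p => ‖localDefect F c θ p‖).bddAbove
  filter_upwards [eventually_le_mul_sqrt (norm_nonneg _) ha (C ^ 2 * (1 + F.card))]
    with δ hδ d σ φ hφ
  exact hδ d _ (norm_sq_shiftOp_microVec_sub_le hβ hφ hc hf fun p => hC ⟨p, rfl⟩)

theorem eventually_hammingDist_coloring_le (hβ : Measurable β) (hF : 1 ∈ F) {π : B → A}
    {θ : κ → B → ℂ} {N : Set B} {a r γ : ℝ} (hr : 0 < r)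
    (hsep : ∀ b ∉ N, ∀ b' ∉ N, (∀ k, ‖θ k b - θ k b'‖ < r) → π b = π b')
    (hγ : 2 * μ.real (β ⁻¹' N) + Fintype.card κ * (a / r) ^ 2 < γ) :
    ∀ᶠ δ in 𝓝 (0 : ℝ), ∀ (d : ℕ) (σ : Γ → Equiv.Perm (Fin d)), ∀ φ ∈ AP μ β F hF δ σ,
      ∀ ψ ∈ AP μ β F hF δ σ, (∀ k, ‖microVec hF (θ k) φ - microVec hF (θ k) ψ‖ ≤ a * √d) →
      (hammingDist (fun j => π (φ j ⟨1, hF⟩)) (fun j => π (ψ j ⟨1, hF⟩)) : ℝ) ≤ γ * d := by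
  classical
  have hlim : Tendsto (fun δ => 2 * (μ.real (β ⁻¹' N) + δ) + Fintype.card κ * (a / r) ^ 2) (𝓝 0)
      (𝓝 (2 * μ.real (β ⁻¹' N) + Fintype.card κ * (a / r) ^ 2)) :=
    (by fun_prop : Continuous _).tendsto' 0 _ (by ring)
  filter_upwards [hlim.eventually (gt_mem_nhds hγ)] with δ hδ d σ φ hφ ψ hψ hφψ
  have hdist := hammingDist_comp_le_of_separating hr hsep (fun j => φ j ⟨1, hF⟩)
    (fun j => ψ j ⟨1, hF⟩) (t := (a * √d) ^ 2) fun k => by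
      have hk := pow_le_pow_left₀ (norm_nonneg _) (hφψ k) 2
      rwa [EuclideanSpace.norm_sq_eq] at hk
  rw [mul_pow, Real.sq_sqrt d.cast_nonneg] at hdist
  have hφN := card_filter_mem_le_of_mem_AP hβ hφ N
  have hψN := card_filter_mem_le_of_mem_AP hβ hψ N
  calc _ ≤ d * (μ.real (β ⁻¹' N) + δ) + d * (μ.real (β ⁻¹' N) + δ) +
        Fintype.card κ * (a ^ 2 * d / r ^ 2) := hdist.trans (by gcongr)
    _ = (2 * (μ.real (β ⁻¹' N) + δ) + Fintype.card κ * (a / r) ^ 2) * d := by ring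
    _ ≤ γ * d := by gcongr

theorem eventually_ncard_colorings_le [SMulInvariantMeasure Γ X μ] [Finite A] (hβ : Measurable β)
    (hF : 1 ∈ F) {π : B → A} {θ : κ → B → ℂ} {f : κ → Lp ℂ 2 μ} (hf : ∀ k, f k =ᵐ[μ] θ k ∘ β)
    {N : Set B} {c : Γ →₀ ℂ} (hc : c.support ⊆ F) {R a r γ : ℝ} (hR₀ : 0 < R) (ha₀ : 0 < a)
    (hr : 0 < r) (hR : ∀ k, ‖f k‖ < R)
    (ha : ∀ k, ‖UnitaryRep.linearExtension (koopman Γ μ) c (f k) - f k‖ < a)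
    (hsep : ∀ b ∉ N, ∀ b' ∉ N, (∀ k, ‖θ k b - θ k b'‖ < r) → π b = π b')
    (hγ : 2 * μ.real (β ⁻¹' N) + Fintype.card κ * (8 * a / r) ^ 2 < γ) :
    ∀ᶠ δ in 𝓝 (0 : ℝ), ∀ (d : ℕ) (_ : 0 < d) (σ : Γ → Equiv.Perm (Fin d)) (M : ℝ), 0 ≤ M →
      (∀ y : Fin d → A, ({z | (hammingDist y z : ℝ) ≤ γ * d}.ncard : ℝ) ≤ M) →
      (((fun φ : Fin d → F → B => fun j => π (φ j ⟨1, hF⟩)) '' AP μ β F hF δ σ).ncard : ℝ) ≤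
        Real.exp (2 * Fintype.card κ * ((R / a) ^ 2 *
          ∑ l, ‖shiftOp σ c (EuclideanSpace.basisFun (Fin d) ℂ l)‖ ^ 2) *
            Real.log (2 + R / (2 * a))) * M := by
  filter_upwards [eventually_all.2 fun k => eventually_norm_microVec_le hβ hF (hf k) (hR k),
    eventually_all.2 fun k => eventually_norm_shiftOp_microVec_sub_le hβ hF hc (hf k) (ha k),
    eventually_hammingDist_coloring_le hβ hF hr hsep hγ] with δ hnorm hfix hdist d hd σ M hM hball
  have hsqrt : 0 < √(d : ℝ) := by positivity
  have hcount := ncard_image_le_exp_mul_of_norm_apply_sub_le (EuclideanSpace.basisFun (Fin d) ℂ)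
    (shiftOp σ c : EuclideanSpace ℂ (Fin d) →ₗ[ℂ] EuclideanSpace ℂ (Fin d)) (AP μ β F hF δ σ)
    (fun φ j => π (φ j ⟨1, hF⟩)) (fun φ k => microVec hF (θ k) φ)
    (fun y => {z | (hammingDist y z : ℝ) ≤ γ * d}) (mul_pos hR₀ hsqrt) (mul_pos ha₀ hsqrt) hM
    (fun φ hφ k => hnorm k d σ φ hφ) (fun φ hφ k => hfix k d σ φ hφ)
    (fun φ hφ ψ hψ hφψ => hdist d σ ψ hψ φ hφ fun k => by
      rw [mul_assoc, norm_sub_rev]; exact hφψ k) hball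
  rwa [mul_div_mul_right _ _ hsqrt.ne', ← mul_assoc 2 a, mul_div_mul_right _ _ hsqrt.ne'] at hcount

end Colorings

/-! ### Refining observables -/

theorem separating_of_norm_sub_lt {X ι A B : Type*} {α : X → A} {β : X → B} {π : B → A}
    (hπ : ∀ x, π (β x) = α x) {f : ι → X → ℂ} {θ : ι → B → ℂ} {r : ℝ} {bad : Set X}
    (hsep : ∀ x ∉ bad, ∀ y ∉ bad, (∀ k, ‖f k x - f k y‖ < r) → α x = α y)
    (hnear : ∀ x ∉ bad, ∀ k, ‖θ k (β x) - f k x‖ < r / 3) :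
    ∀ b ∉ {b | β ⁻¹' {b} ⊆ bad}, ∀ b' ∉ {b | β ⁻¹' {b} ⊆ bad},
      (∀ k, ‖θ k b - θ k b'‖ < r / 3) → π b = π b' := by
  intro b hb b' hb' hbb'
  obtain ⟨x, rfl, hx⟩ := Set.not_subset.1 hb
  obtain ⟨y, rfl, hy⟩ := Set.not_subset.1 hb'
  rw [hπ, hπ]
  refine hsep x hx y hy fun k => ?_
  calc ‖f k x - f k y‖
      = ‖(f k x - θ k (β x)) + (θ k (β x) - θ k (β y)) + (θ k (β y) - f k y)‖ := by
        congr 1; ring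
    _ ≤ ‖f k x - θ k (β x)‖ + ‖θ k (β x) - θ k (β y)‖ + ‖θ k (β y) - f k y‖ := norm_add₃_le
    _ < r := by
      rw [norm_sub_rev (f k x)]
      linarith [hnear x hx k, hnear y hy k, hbb' k]

section Refinement

variable {X : Type*} [MeasurableSpace X] {μ : Measure X} {ι : Type*}

theorem eventually_measure_exists_le_norm_sub_le [Finite ι] (f : ι → Lp ℂ 2 μ) {r : ℝ}
    (hr : 0 < r) {η : ℝ≥0∞} (hη : η ≠ 0) :
    ∀ᶠ f' in 𝓝 f, μ {x | ∃ k, r ≤ ‖f' k x - f k x‖} ≤ η := by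
  have := Fintype.ofFinite ι
  have hlim (k : ι) : Tendsto (fun f' : ι → Lp ℂ 2 μ => μ {x | r ≤ ‖f' k x - f k x‖}) (𝓝 f)
      (𝓝 0) := by
    have hmeas : TendstoInMeasure μ (fun f' x => f' x) (𝓝 (f k)) (f k) :=
      tendstoInMeasure_of_tendsto_Lp tendsto_id
    exact (tendstoInMeasure_iff_norm.1 hmeas r hr).comp (tendsto_pi_nhds.1 tendsto_id k)
  have hsum := tendsto_finsetSum Finset.univ fun k _ => hlim k
  rw [Finset.sum_const_zero] at hsum
  filter_upwards [hsum.eventually (gt_mem_nhds (pos_iff_ne_zero.2 hη))] with f' hf'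
  rw [Set.ofPred_exists]
  exact (measure_iUnion_fintype_le _ _).trans hf'.le

theorem exists_finite_refinement [Finite ι] {A : Type*} [Finite A] [MeasurableSpace A]
    [MeasurableSingletonClass A] {α : X → A} (hα : Measurable α) {f : ι → Lp ℂ 2 μ}
    {U : Set (ι → Lp ℂ 2 μ)} (hU : U ∈ 𝓝 f) :
    ∃ (m : ℕ) (β : X → Fin m) (π : Fin m → A) (θ : ι → Fin m → ℂ) (f' : ι → Lp ℂ 2 μ),
      Measurable β ∧ (∀ x, π (β x) = α x) ∧ (∀ k, f' k =ᵐ[μ] θ k ∘ β) ∧ f' ∈ U := by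
  have hdense : DenseRange (Pi.map fun (_ : ι) (q : Lp.simpleFunc ℂ 2 μ) => (q : Lp ℂ 2 μ)) :=
    DenseRange.piMap fun _ => Lp.simpleFunc.denseRange ENNReal.ofNat_ne_top
  obtain ⟨_, hqU, q, rfl⟩ := mem_closure_iff_nhds.1 (hdense f) U hU
  let u : ι → SimpleFunc X ℂ := fun k => Lp.simpleFunc.toSimpleFunc (q k)
  let ζ : X → A × ∀ k, (u k).range := fun x => (α x, fun k => ⟨u k x, (u k).mem_range_self x⟩)
  have hζ : Measurable ζ :=
    hα.prodMk (measurable_pi_iff.2 fun k => (u k).measurable.subtype_mk)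
  obtain ⟨m, ⟨e⟩⟩ := Finite.exists_equiv_fin (A × ∀ k, (u k).range)
  refine ⟨m, e ∘ ζ, fun b => (e.symm b).1, fun k b => (e.symm b).2 k, fun k => q k,
    (measurable_of_finite e).comp hζ, fun x => ?_, fun k => ?_, hqU⟩
  · simp only [Function.comp_apply, e.symm_apply_apply, ζ]
  · filter_upwards [Lp.simpleFunc.toSimpleFunc_eq_toFun (q k)] with x hx
    simp only [← hx, Function.comp_apply, e.symm_apply_apply, ζ, u]

theorem ApproxDetermined.exists_refinement {H : Submodule ℂ (Lp ℂ 2 μ)} {A : Type*} [Finite A]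
    [MeasurableSpace A] [MeasurableSingletonClass A] {α : X → A} (h : ApproxDetermined H α)
    (hα : Measurable α) {η : ℝ} (hη : 0 < η) :
    ∃ (s : Finset H) (r : ℝ), 0 < r ∧ ∀ U ∈ 𝓝 (fun f : s => (f : Lp ℂ 2 μ)),
      ∃ (m : ℕ) (β : X → Fin m) (π : Fin m → A) (θ : s → Fin m → ℂ) (f' : s → Lp ℂ 2 μ)
        (N : Set (Fin m)), Measurable β ∧ (∀ x, π (β x) = α x) ∧ (∀ k, f' k =ᵐ[μ] θ k ∘ β) ∧
        f' ∈ U ∧ μ.real (β ⁻¹' N) ≤ η ∧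
        ∀ b ∉ N, ∀ b' ∉ N, (∀ k, ‖θ k b - θ k b'‖ < r) → π b = π b' := by
  have hη₂ : ENNReal.ofReal η / 2 ≠ 0 := by simpa using hη
  obtain ⟨s, r, hr, bad, hbad, hsep⟩ := h _ hη₂
  refine ⟨s, r / 3, by positivity, fun U hU => ?_⟩
  obtain ⟨m, β, π, θ, f', hβ, hπ, hf', hf'U, hclose⟩ := exists_finite_refinement hα
    (inter_mem hU (eventually_measure_exists_le_norm_sub_le _ (by positivity : 0 < r / 3) hη₂))
  let far : Set X := {x | ∃ k : s, r / 3 ≤ ‖f' k x - k.1.1 x‖}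
  let null : Set X := {x | ¬ ∀ k, f' k x = θ k (β x)}
  have hnull : μ null = 0 := ae_iff.1 (ae_all_iff.2 hf')
  have hμ : μ (bad ∪ far ∪ null) ≤ ENNReal.ofReal η := by
    calc μ (bad ∪ far ∪ null) ≤ μ bad + μ far + μ null :=
          (measure_union_le _ _).trans (add_le_add_left (measure_union_le _ _) _)
      _ ≤ ENNReal.ofReal η / 2 + ENNReal.ofReal η / 2 + 0 :=
          add_le_add (add_le_add hbad hclose) hnull.le
      _ = ENNReal.ofReal η := by rw [add_zero, ENNReal.add_halves]
  refine ⟨m, β, π, θ, f', {b | β ⁻¹' {b} ⊆ bad ∪ far ∪ null}, hβ, hπ, hf', hf'U,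
    ENNReal.toReal_le_of_le_ofReal hη.le ((measure_mono fun x hx => ?_).trans hμ), ?_⟩
  · exact hx rfl
  refine separating_of_norm_sub_lt hπ (f := fun k : s => k.1.1) (fun x hx y hy hxy =>
    hsep x (fun h => hx (.inl (.inl h))) y (fun h => hy (.inl (.inl h))) fun f hf =>
      hxy ⟨f, hf⟩) fun x hx k => ?_
  simp only [far, null, Set.mem_union, Set.mem_ofPred_eq, not_or, not_exists, not_le,
    not_not] at hx
  rw [← hx.2 k]
  exact hx.1.2 k

end Refinement

/-! ### Entropy bounds -/

theorem log_natCast_div_le_of_le_exp {N d : ℕ} (hd : 0 < d) {ε : ℝ}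
    (h : (N : ℝ) ≤ Real.exp (ε * d)) :
    ENNReal.log (N : ℝ≥0∞) / ((d : ℝ) : EReal) ≤ (ε : EReal) := by
  have hN : (N : ℝ≥0∞) ≤ ENNReal.ofReal (Real.exp (ε * d)) := by
    rw [← ENNReal.ofReal_natCast]
    exact ENNReal.ofReal_le_ofReal h
  rw [EReal.div_le_iff_le_mul (by exact_mod_cast hd) (EReal.coe_ne_top _), ← EReal.coe_mul]
  refine (ENNReal.log_monotone hN).trans_eq ?_
  rw [ENNReal.log_ofReal_of_pos (Real.exp_pos _), Real.log_exp, mul_comm]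

section Entropy

variable {Γ : Type*} [Group Γ] (Sg : SoficApproximation Γ) {X : Type*} [MeasurableSpace X]
  [MulAction Γ X] [MeasurableConstSMul Γ X] {μ : Measure X} [SMulInvariantMeasure Γ X μ]
  [IsFiniteMeasure μ] {A : Type*} [Finite A]

theorem obsEntropyRel_le [DecidableEq A] {B κ : Type*} [Fintype B] [MeasurableSpace B]
    [MeasurableSingletonClass B] [Fintype κ] {β : X → B} (hβ : Measurable β) {π : B → A}
    {θ : κ → B → ℂ} {f : κ → Lp ℂ 2 μ} (hf : ∀ k, f k =ᵐ[μ] θ k ∘ β) {N : Set B} {c : Γ →₀ ℂ}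
    {τ R a r γ ε : ℝ} (hτ : ∑ g ∈ c.support, ‖c g‖ ^ 2 < τ) (hR₀ : 0 < R) (ha₀ : 0 < a)
    (hr : 0 < r) (hR : ∀ k, ‖f k‖ < R)
    (ha : ∀ k, ‖UnitaryRep.linearExtension (koopman Γ μ) c (f k) - f k‖ < a)
    (hsep : ∀ b ∉ N, ∀ b' ∉ N, (∀ k, ‖θ k b - θ k b'‖ < r) → π b = π b')
    (hγ : 2 * μ.real (β ⁻¹' N) + Fintype.card κ * (8 * a / r) ^ 2 < γ)
    (hball : ∀ (d : ℕ) (y : Fin d → A),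
      ({z | (hammingDist y z : ℝ) ≤ γ * d}.ncard : ℝ) ≤ Real.exp (ε * d)) :
    obsEntropyRel Sg μ β π ≤
      ((2 * Fintype.card κ * ((R / a) ^ 2 * τ) * Real.log (2 + R / (2 * a)) + ε : ℝ) : EReal) := by
  classical
  have hF : 1 ∈ insert 1 c.support := Finset.mem_insert_self _ _
  obtain ⟨δ, hcount, hδ⟩ := ((eventually_ncard_colorings_le hβ hF hf (Finset.subset_insert _ _)
    hR₀ ha₀ hr hR ha hsep hγ).filter_mono nhdsWithin_le_nhds |>.and
      (eventually_mem_nhdsWithin (s := Set.Ioi (0 : ℝ)))).exists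
  refine iInf_le_of_le _ (iInf_le_of_le hF (iInf_le_of_le δ (iInf_le_of_le hδ ?_)))
  refine limsup_le_of_le (by isBoundedDefault) ?_
  filter_upwards [Sg.eventually_sum_norm_sq_shiftOp_le hτ] with i hi
  refine log_natCast_div_le_of_le_exp (Sg.d_pos i) ?_
  refine (hcount _ (Sg.d_pos i) _ _ (Real.exp_pos _).le (hball _)).trans ?_
  have hlog : 0 ≤ Real.log (2 + R / (2 * a)) :=
    Real.log_nonneg (by linarith [div_pos hR₀ (mul_pos two_pos ha₀)])
  rw [← Real.exp_add, Real.exp_le_exp]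
  calc _ ≤ 2 * Fintype.card κ * ((R / a) ^ 2 * (τ * Sg.d i)) * Real.log (2 + R / (2 * a)) +
        ε * Sg.d i := by gcongr
    _ = _ := by ring

theorem ApproxDetermined.obsEntropy_le {H : Submodule ℂ (Lp ℂ 2 μ)}
    (hH : (koopman Γ μ).IsSubrep H)
    (hsing : ((koopman Γ μ).restrict H hH).Singular (leftRegular Γ)) [MeasurableSpace A]
    [MeasurableSingletonClass A] {α : X → A} (h : ApproxDetermined H α) (hα : Measurable α) {ε : ℝ}
    (hε : 0 < ε) : obsEntropy Sg μ α ≤ (ε : EReal) := by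
  classical
  obtain ⟨γ, hγ, hball⟩ := exists_ncard_hammingBall_le_exp A (half_pos hε)
  obtain ⟨s, r, hr, href⟩ := h.exists_refinement hα (by positivity : 0 < γ / 8)
  obtain ⟨a, ha₀, ha⟩ : ∃ a > 0, Fintype.card s * (8 * a / r) ^ 2 < γ / 2 := by
    have hlim : Tendsto (fun a : ℝ => Fintype.card s * (8 * a / r) ^ 2) (𝓝[>] 0) (𝓝 0) :=
      ((by fun_prop : Continuous _).tendsto' 0 _ (by simp)).mono_left nhdsWithin_le_nhds
    exact (eventually_mem_nhdsWithin.and (hlim.eventually (gt_mem_nhds (by positivity)))).exists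
  obtain ⟨R, hR₀, hR⟩ : ∃ R > 0, ∀ f : s, ‖(f : Lp ℂ 2 μ)‖ < R :=
    ((eventually_gt_atTop 0).and (eventually_all.2 fun f : s => eventually_gt_atTop _)).exists
  obtain ⟨τ, hτ₀, hτ⟩ := exists_pos_mul_lt (half_pos hε)
    (2 * Fintype.card s * (R / a) ^ 2 * Real.log (2 + R / (2 * a)))
  have : CompleteSpace H := hH.1.completeSpace_coe
  obtain ⟨c, hcτ, hc⟩ := hsing.exists_linearExtension_near (fun f : s => (f : H)) hτ₀ ha₀
  let L := UnitaryRep.linearExtension (koopman Γ μ) c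
  have hnhds : ∀ᶠ f' in 𝓝 fun f : s => (f : Lp ℂ 2 μ), ∀ k, ‖f' k‖ < R ∧ ‖L (f' k) - f' k‖ < a :=
    eventually_all.2 fun k => by
      have hk : Tendsto (fun f' : s → Lp ℂ 2 μ => f' k) (𝓝 fun f => (f : Lp ℂ 2 μ))
          (𝓝 (k : Lp ℂ 2 μ)) :=
        tendsto_pi_nhds.1 tendsto_id k
      refine hk.eventually ((continuous_norm.tendsto _ |>.eventually_lt_const (hR k)).and
        (((L.continuous.sub continuous_id).norm.tendsto _).eventually_lt_const ?_))
      simpa [L, UnitaryRep.coe_linearExtension_restrict] using! hc k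
  obtain ⟨m, β, π, θ, f', N, hβ, hπ, hf', hf'U, hN, hsep⟩ := href _ hnhds
  refine iInf_le_of_le m (iInf_le_of_le β (iInf_le_of_le hβ (iInf_le_of_le π
    (iInf_le_of_le (ae_of_all _ hπ) ?_))))
  refine (obsEntropyRel_le Sg hβ hf' hcτ hR₀ ha₀ hr (fun k => (hf'U k).1) (fun k => (hf'U k).2)
    hsep (γ := γ) (by linarith) fun d y => by simpa using hball y).trans ?_
  exact EReal.coe_le_coe_iff.2 (by linarith)

theorem soficEntropy_nonpos_of_singular {H : Submodule ℂ (Lp ℂ 2 μ)}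
    (hH : (koopman Γ μ).IsSubrep H) (hgen : Generates Γ H)
    (hsing : ((koopman Γ μ).restrict H hH).Singular (leftRegular Γ)) : soficEntropy Sg μ ≤ 0 :=
  iSup_le fun _ => iSup_le fun _ => iSup_le fun hα => EReal.le_of_forall_lt_iff_le.1 fun _ hε =>
    (hgen.approxDetermined hH hα).obsEntropy_le Sg hH hsing hα (by exact_mod_cast hε)

end Entropy

/-! ### Removing the constants -/

theorem eq_zero_of_leftRegular_invariant {Γ : Type*} [Group Γ] [Infinite Γ]
    {f : lp (fun _ : Γ => ℂ) 2} (hf : ∀ g, leftRegular Γ g f = f) : f = 0 := by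
  have hconst : ∀ x, f x = f 1 := fun x => by
    have h : f (x⁻¹⁻¹ * 1) = f 1 := congrArg (fun u : lp (fun _ : Γ => ℂ) 2 => u 1) (hf x⁻¹)
    simpa using h
  have hsum := (memℓp_gen_iff (p := 2) (by norm_num)).1 (lp.memℓp f)
  simp_rw [hconst] at hsum
  have hf₁ : f 1 = 0 := by
    by_contra hne
    exact (Real.rpow_pos_of_pos (norm_pos_iff.2 hne) _).ne' ((summable_const_iff _).1 hsum)
  ext x
  rw [hconst, hf₁, lp.coeFn_zero, Pi.zero_apply]

/-- A subrepresentation of `H` meeting `Z` trivially consists of fixed vectors, because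
`ρ g v - v ∈ Z`, and `ℓ²` of an infinite group has no fixed vectors. -/
theorem UnitaryRep.Singular.of_inf {Γ : Type*} [Group Γ] [Infinite Γ] {E : Type*}
    [NormedAddCommGroup E] [InnerProductSpace ℂ E] {ρ : UnitaryRep Γ E} {H Z : Submodule ℂ E}
    {hH : ρ.IsSubrep H} {hHZ : ρ.IsSubrep (H ⊓ Z)} (hZ : ∀ g v, ρ g v - v ∈ Z)
    (hsing : (ρ.restrict (H ⊓ Z) hHZ).Singular (leftRegular Γ)) :
    (ρ.restrict H hH).Singular (leftRegular Γ) := by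
  intro K hK T hT
  let j : (H ⊓ Z : Submodule ℂ E) →ₗ[ℂ] H := Submodule.inclusion inf_le_left
  let K' := K.comap j
  have hK' : (ρ.restrict (H ⊓ Z) hHZ).IsSubrep K' :=
    ⟨hK.1.preimage (continuous_subtype_val.subtype_mk _), fun g v hv => hK.2 g (j v) hv⟩
  have hbot : K' = ⊥ := hsing K' hK'
    ⟨T.toLinearMap ∘ₗ j.restrict (p := K') (q := K) fun v hv => hv, fun v => T.norm_map _⟩
    fun g v => hT g (j.restrict (p := K') (q := K) (fun v hv => hv) v)
  have hfixed (g : Γ) (v : K) : (ρ.restrict H hH).restrict K hK g v = v := by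
    have hmem : (⟨ρ g v - v, H.sub_mem (hH.2 g v (v : H).2) (v : H).2, hZ g v⟩ :
        (H ⊓ Z : Submodule ℂ E)) ∈ K' := K.sub_mem (hK.2 g v v.2) v.2
    rw [hbot, Submodule.mem_bot] at hmem
    exact Subtype.ext (Subtype.ext (sub_eq_zero.1 (congrArg Subtype.val hmem)))
  refine (Submodule.eq_bot_iff _).2 fun v hv => ?_
  have hTv : T ⟨v, hv⟩ = 0 := eq_zero_of_leftRegular_invariant fun g => by rw [← hT, hfixed]
  exact congrArg Subtype.val ((map_eq_zero_iff T T.injective).1 hTv)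

section MeanZero

variable {Γ : Type*} [Group Γ] {X : Type*} [MeasurableSpace X] [MulAction Γ X]
  [MeasurableConstSMul Γ X] {μ : Measure X} [SMulInvariantMeasure Γ X μ]

theorem koopman_const [IsFiniteMeasure μ] (g : Γ) (z : ℂ) :
    koopman Γ μ g (Lp.const 2 μ z) = Lp.const 2 μ z :=
  Lp.ext <| (coeFn_koopman g _).trans <|
    ((measurePreserving_smul g⁻¹ μ).quasiMeasurePreserving.ae_eq_comp (Lp.coeFn_const 2 μ z)).trans
      (Lp.coeFn_const 2 μ z).symm

theorem koopman_sub_mem_meanZero [IsProbabilityMeasure μ] (g : Γ) (f : Lp ℂ 2 μ) :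
    koopman Γ μ g f - f ∈ meanZero μ := by
  rw [meanZero, Submodule.mem_orthogonal_singleton_iff_inner_right, inner_sub_right, sub_eq_zero]
  have h := (koopman Γ μ g).inner_map_map (Lp.const 2 μ (1 : ℂ)) f
  rwa [koopman_const] at h

end MeanZero

theorem theorem1p1_general {Γ : Type*} [Group Γ] (Sg : SoficApproximation Γ) {X : Type*}
    [MeasurableSpace X] [MulAction Γ X] [MeasurableConstSMul Γ X] (μ : Measure X)
    [IsProbabilityMeasure μ] [SMulInvariantMeasure Γ X μ] (H : Submodule ℂ (Lp ℂ 2 μ))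
    (hH : (koopman Γ μ).IsSubrep H) (hgen : Generates Γ H) :
    (((koopman Γ μ).restrict H hH).Singular (leftRegular Γ) → soficEntropy Sg μ ≤ 0) ∧
    (Infinite Γ →
      ((koopman Γ μ).restrict (H ⊓ meanZero μ) (hH.inf (isSubrep_meanZero Γ μ))).Singular
        (leftRegular Γ) → soficEntropy Sg μ ≤ 0) :=
  ⟨soficEntropy_nonpos_of_singular Sg hH hgen, fun _ hsing =>
    soficEntropy_nonpos_of_singular Sg hH hgen (hsing.of_inf koopman_sub_mem_meanZero)⟩

theorem theorem1p1 {Γ : Type*} [Group Γ] [Countable Γ] (Sg : SoficApproximation Γ)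
    {X : Type*} [MeasurableSpace X] [StandardBorelSpace X] [MulAction Γ X]
    [MeasurableConstSMul Γ X] (μ : Measure X) [IsProbabilityMeasure μ] [SMulInvariantMeasure Γ X μ]
    (H : Submodule ℂ (Lp ℂ 2 μ)) (hH : (koopman Γ μ).IsSubrep H) (hgen : Generates Γ H) :
    (((koopman Γ μ).restrict H hH).Singular (leftRegular Γ) → soficEntropy Sg μ ≤ 0) ∧
    (Infinite Γ →
      ((koopman Γ μ).restrict (H ⊓ meanZero μ) (hH.inf (isSubrep_meanZero Γ μ))).Singular
        (leftRegular Γ) → soficEntropy Sg μ ≤ 0) :=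
  theorem1p1_general Sg μ H hH hgen
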